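/- A connection $\nabla$ on the tangent bundle of a smooth surface may have torsion; write $R(X,Y)=\nabla_X\nabla_Y-\nabla_Y\nabla_X-\nabla_{[X,Y]}$, $\rho(X,Y)=\operatorname{Trace}(Z\mapsto R(Z,X)Y)$ and $T(X,Y)=\frac12(\nabla_XY-\nabla_YX-[X,Y])$. For $(u,v)\in\mathbb R^2$ let $\mathcal M_{u,v}$ be $\mathbb R^2$ with the connection $\nabla_{\partial_i}\partial_j=\sum_k\Gamma_{ij}{}^k\partial_k$ whose only possibly non-zero Christoffel symbols are $\Gamma_{11}{}^1=1$, $\Gamma_{12}{}^1=2u$, $\Gamma_{22}{}^1=v$ (in particular $\Gamma_{21}{}^1=0$). An affine surface is homogeneous if its affine (connection preserving) diffeomorphisms act transitively, and $\mathcal M$ is modeled on $\mathcal N$ if $\mathcal N$ is homogeneous and $\mathcal M$ is covered by open sets that are affine isomorphic to open subsets of $\mathcal N$. Theorem. Let $\mathcal M=(M,\nabla)$ be a connected smooth surface with a smooth connection such that $\nabla R=0$, $\nabla T=0$ and $T\neq 0$. Then $\mathcal M$ is modeled on one of the following structures. (1) $\mathcal M_{1,0}$, that is $\Gamma_{11}{}^1=1$,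 $\Gamma_{12}{}^1=2$; here $\rho=0$. (2) $\mathcal M_{u,\pm1}$ for some $u>0$, that is $\Gamma_{11}{}^1=1$, $\Gamma_{12}{}^1=2u$, $\Gamma_{22}{}^1=\pm1$; here $\rho=\pm\,dx^2\otimes dx^2$. All the structures $\mathcal M_{1,0}$ and $\mathcal M_{u,\pm1}$ $(u>0)$ are homogeneous, and they are pairwise inequivalent: for two different ones there is no affine diffeomorphism between them, and not even an affine isomorphism between non-empty open subsets. -/

import Mathlib

open Set Bundle FiberBundle VectorField
open scoped Manifold ContDiff

noncomputable section

namespace AffineSurface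

/-- The plane `ℝ²`, on which all surfaces are modeled. -/
abbrev Plane : Type := EuclideanSpace ℝ (Fin 2)

/-- A connection on the tangent bundle of a surface `M`. For vector fields `X`, `Y` the vector
`(∇_X Y)(x)` is `cov Y x (X x)`. Smoothness is the class `IsSmoothConnection`. -/
abbrev Connection (M : Type*) [TopologicalSpace M] [ChartedSpace Plane M]
    [IsManifold (𝓡 2) ∞ M] : Type _ :=
  CovariantDerivative (𝓡 2) Plane (TangentSpace (𝓡 2) : M → Type _)

/-- The connection is of class `C^∞`. -/
abbrev IsSmoothConnection {M : Type*} [TopologicalSpace M] [ChartedSpace Plane M]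
    [IsManifold (𝓡 2) ∞ M] (cov : Connection M) : Prop :=
  CovariantDerivative.ContMDiffCovariantDerivative cov ∞

section Tensors

variable {M : Type*} [TopologicalSpace M] [ChartedSpace Plane M] [IsManifold (𝓡 2) ∞ M]

/-- `X` is a smooth vector field on `M`. -/
def IsSmoothField (X : Π x : M, TangentSpace (𝓡 2) x) : Prop :=
  ContMDiff (𝓡 2) (𝓡 2).tangent ∞ (fun x ↦ (⟨x, X x⟩ : TangentBundle (𝓡 2) M))

/-- The vector field `∇_X Y`. -/
def nabla (cov : Connection M) (X Y : Π x : M, TangentSpace (𝓡 2) x) :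
    Π x : M, TangentSpace (𝓡 2) x :=
  fun x ↦ cov Y x (X x)

/-- The vector field `R(X,Y)Z = ∇_X ∇_Y Z - ∇_Y ∇_X Z - ∇_{[X,Y]} Z`. -/
def curvature (cov : Connection M) (X Y Z : Π x : M, TangentSpace (𝓡 2) x) :
    Π x : M, TangentSpace (𝓡 2) x :=
  nabla cov X (nabla cov Y Z) - nabla cov Y (nabla cov X Z)
    - nabla cov (mlieBracket (𝓡 2) X Y) Z

/-- The vector field `T(X,Y)`, where `T(X,Y) = ½ (∇_X Y - ∇_Y X - [X,Y])`. -/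
def torsion (cov : Connection M) (X Y : Π x : M, TangentSpace (𝓡 2) x) :
    Π x : M, TangentSpace (𝓡 2) x :=
  (1 / 2 : ℝ) • (nabla cov X Y - nabla cov Y X - mlieBracket (𝓡 2) X Y)

/-- The Ricci tensor `ρ_x(v,w) = Trace (z ↦ R(z,v)w)`, the trace being computed in the standard
basis of `T_x M = ℝ²`, and tangent vectors at `x` being extended to vector fields smooth near `x`. -/
def ricci (cov : Connection M) (x : M) (v w : TangentSpace (𝓡 2) x) : ℝ :=
  ∑ k : Fin 2,
    (show Plane from
      curvature cov
        (extend Plane (show TangentSpace (𝓡 2) x from EuclideanSpace.single k (1 : ℝ)))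
        (extend Plane v) (extend Plane w) x) k

/-- `∇R = 0`, that is `(∇_W R)(X,Y)Z = 0` for all smooth vector fields. An affine surface with
this property is called symmetric. -/
def IsSymmetric (cov : Connection M) : Prop :=
  ∀ W X Y Z : Π x : M, TangentSpace (𝓡 2) x,
    IsSmoothField W → IsSmoothField X → IsSmoothField Y → IsSmoothField Z →
      nabla cov W (curvature cov X Y Z) - curvature cov (nabla cov W X) Y Z
        - curvature cov X (nabla cov W Y) Z - curvature cov X Y (nabla cov W Z) = 0

/-- `∇T = 0`, that is `(∇_W T)(X,Y) = 0` for all smooth vector fields. -/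
def HasParallelTorsion (cov : Connection M) : Prop :=
  ∀ W X Y : Π x : M, TangentSpace (𝓡 2) x,
    IsSmoothField W → IsSmoothField X → IsSmoothField Y →
      nabla cov W (torsion cov X Y) - torsion cov (nabla cov W X) Y
        - torsion cov X (nabla cov W Y) = 0

/-- The torsion tensor does not vanish identically. -/
def HasNonzeroTorsion (cov : Connection M) : Prop :=
  ∃ X Y : Π x : M, TangentSpace (𝓡 2) x,
    IsSmoothField X ∧ IsSmoothField Y ∧ torsion cov X Y ≠ 0

end Tensors

section Maps

variable {M : Type*} [TopologicalSpace M] [ChartedSpace Plane M] [IsManifold (𝓡 2) ∞ M]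
  {N : Type*} [TopologicalSpace N] [ChartedSpace Plane N] [IsManifold (𝓡 2) ∞ N]

/-- On the set `s` the map `f` (a local diffeomorphism there) intertwines the two connections:
`df (∇_{f^*X} f^*Y) = (∇'_X Y) ∘ f` for all smooth vector fields `X`, `Y` on the target, where
`f^*X = df⁻¹ (X ∘ f)`. -/
def PreservesConnectionOn (cov : Connection M) (cov' : Connection N) (f : M → N) (s : Set M) :
    Prop :=
  ∀ X Y : Π y : N, TangentSpace (𝓡 2) y, IsSmoothField X → IsSmoothField Y →
    ∀ x ∈ s,
      mfderiv (𝓡 2) (𝓡 2) f x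
        (nabla cov (mpullback (𝓡 2) (𝓡 2) f X) (mpullback (𝓡 2) (𝓡 2) f Y) x) =
      nabla cov' X Y (f x)

/-- `φ` is an affine isomorphism of the open set `φ.source` of `M` onto the open set `φ.target`
of `N`. -/
def IsLocalAffineIso (cov : Connection M) (cov' : Connection N)
    (φ : PartialDiffeomorph (𝓡 2) (𝓡 2) M N ∞) : Prop :=
  PreservesConnectionOn cov cov' φ φ.source

/-- `φ` is an affine diffeomorphism of `M` onto `N`. -/
def IsAffineDiffeo (cov : Connection M) (cov' : Connection N)
    (φ : Diffeomorph (𝓡 2) (𝓡 2) M N ∞) : Prop :=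
  PreservesConnectionOn cov cov' φ univ

/-- The affine diffeomorphisms act transitively. -/
def IsHomogeneous (cov : Connection M) : Prop :=
  ∀ p q : M, ∃ φ : Diffeomorph (𝓡 2) (𝓡 2) M M ∞, IsAffineDiffeo cov cov φ ∧ φ p = q

/-- `M` is modeled on `N`: `N` is homogeneous, and `M` is covered by open sets that are affine
isomorphic to open subsets of `N`. -/
def IsModeledOn (cov : Connection M) (cov' : Connection N) : Prop :=
  IsHomogeneous cov' ∧
    ∀ p : M, ∃ φ : PartialDiffeomorph (𝓡 2) (𝓡 2) M N ∞,
      p ∈ φ.source ∧ IsLocalAffineIso cov cov' φ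

/-- `M` and `N` are equivalent: there is an affine diffeomorphism of `M` onto `N`. -/
def AreEquivalent (cov : Connection M) (cov' : Connection N) : Prop :=
  ∃ φ : Diffeomorph (𝓡 2) (𝓡 2) M N ∞, IsAffineDiffeo cov cov' φ

/-- Some non-empty open subset of `M` is affine isomorphic to an open subset of `N`. -/
def AreSomewhereLocallyEquivalent (cov : Connection M) (cov' : Connection N) : Prop :=
  ∃ φ : PartialDiffeomorph (𝓡 2) (𝓡 2) M N ∞,
    φ.source.Nonempty ∧ IsLocalAffineIso cov cov' φ

end Maps

section Models

/-- A vector field on the plane that is differentiable as a section of the tangent bundle is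
differentiable as a map. -/
theorem differentiableAt_of_planeField {Y : Plane → Plane} {x : Plane}
    (hY : MDifferentiableAt (𝓡 2) (𝓡 2).tangent
      (fun y ↦ (⟨y, Y y⟩ : TangentBundle (𝓡 2) Plane)) x) : DifferentiableAt ℝ Y x := by
  have h := (mdifferentiableAt_section (IB := 𝓡 2) (F := Plane)
    (E := (TangentSpace (𝓡 2) : Plane → Type _))
    (fun y ↦ (Y y : TangentSpace (𝓡 2) y)) (b₀ := x)).1 hY
  have h' : (fun b ↦ (trivializationAt Plane (TangentSpace (𝓡 2)) x
      (⟨b, Y b⟩ : TangentBundle (𝓡 2) Plane)).2) = Y := by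
    funext b
    simp
  rw [← mdifferentiableAt_iff_differentiableAt]
  exact cast (congrArg (fun f : Plane → Plane ↦ MDifferentiableAt (𝓡 2) (𝓡 2) f x) h') h

/-- The linear map `v ↦ ∑_{i,j,k} Γ_{ij}^k v^i w^j ∂_k`, where `Γ i j k = Γ_{ij}^k` and indices
run over `0, 1`. -/
def christoffelForm (Γ : Fin 2 → Fin 2 → Fin 2 → ℝ) (w : Plane) : Plane →L[ℝ] Plane :=
  LinearMap.toContinuousLinearMap
    { toFun := fun v ↦ WithLp.toLp 2 fun k ↦ ∑ i, ∑ j, Γ i j k * v i * w j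
      map_add' := fun v v' ↦ by
        ext k
        simp only [PiLp.add_apply, mul_add, add_mul, Finset.sum_add_distrib]
      map_smul' := fun c v ↦ by
        ext k
        simp only [PiLp.smul_apply, smul_eq_mul, RingHom.id_apply, Finset.mul_sum]
        exact Finset.sum_congr rfl fun i _ ↦ Finset.sum_congr rfl fun j _ ↦ by ring }

theorem christoffelForm_apply (Γ : Fin 2 → Fin 2 → Fin 2 → ℝ) (v w : Plane) (k : Fin 2) :
    christoffelForm Γ w v k = ∑ i, ∑ j, Γ i j k * v i * w j := rfl

theorem christoffelForm_add (Γ : Fin 2 → Fin 2 → Fin 2 → ℝ) (w w' : Plane) :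
    christoffelForm Γ (w + w') = christoffelForm Γ w + christoffelForm Γ w' := by
  ext v k
  change christoffelForm Γ (w + w') v k = christoffelForm Γ w v k + christoffelForm Γ w' v k
  simp only [christoffelForm_apply, PiLp.add_apply, mul_add, Finset.sum_add_distrib]

theorem christoffelForm_smul (Γ : Fin 2 → Fin 2 → Fin 2 → ℝ) (c : ℝ) (w : Plane) :
    christoffelForm Γ (c • w) = c • christoffelForm Γ w := by
  ext v k
  change christoffelForm Γ (c • w) v k = c * christoffelForm Γ w v k
  simp only [christoffelForm_apply, PiLp.smul_apply, smul_eq_mul, mul_left_comm _ c,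
    Finset.mul_sum]

/-- The linear map `v ↦ (∇_v Y)(x)`, for the connection `∇_{∂_i} ∂_j = ∑ k, Γ_{ij}^k ∂_k`. -/
def christoffelDeriv (Γ : Fin 2 → Fin 2 → Fin 2 → ℝ) (Y : Plane → Plane) (x : Plane) :
    Plane →L[ℝ] Plane :=
  fderiv ℝ Y x + christoffelForm Γ (Y x)

theorem christoffelDeriv_add (Γ : Fin 2 → Fin 2 → Fin 2 → ℝ) {Y Y' : Plane → Plane} {x : Plane}
    (hY : DifferentiableAt ℝ Y x) (hY' : DifferentiableAt ℝ Y' x) :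
    christoffelDeriv Γ (Y + Y') x = christoffelDeriv Γ Y x + christoffelDeriv Γ Y' x := by
  rw [christoffelDeriv, fderiv_add hY hY', Pi.add_apply, christoffelForm_add]
  exact add_add_add_comm _ _ _ _

theorem christoffelDeriv_smul (Γ : Fin 2 → Fin 2 → Fin 2 → ℝ) {Y : Plane → Plane}
    {g : Plane → ℝ} {x : Plane} (hY : DifferentiableAt ℝ Y x) (hg : DifferentiableAt ℝ g x) :
    christoffelDeriv Γ (g • Y) x =
      g x • christoffelDeriv Γ Y x + (fderiv ℝ g x).smulRight (Y x) := by
  rw [christoffelDeriv, fderiv_smul hg hY, Pi.smul_apply', christoffelForm_smul, christoffelDeriv,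
    smul_add]
  exact add_right_comm _ _ _

/-- The connection on the plane with constant Christoffel symbols `Γ i j k = Γ_{ij}^k`, where
`∇_{∂_i} ∂_j = ∑ k, Γ_{ij}^k ∂_k` and indices run over `0, 1`. -/
def christoffelConnection (Γ : Fin 2 → Fin 2 → Fin 2 → ℝ) : Connection Plane where
  toFun Y x := christoffelDeriv Γ Y x
  isCovariantDerivativeOnUniv :=
    { add := fun hσ hσ' _ ↦ christoffelDeriv_add Γ (differentiableAt_of_planeField hσ)
        (differentiableAt_of_planeField hσ')
      leibniz := fun {σ g x} hσ hg _ ↦ by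
        have h : mvfderiv (𝓡 2) g x = fderiv ℝ g x := mfderiv_eq_fderiv
        rw [h]
        exact christoffelDeriv_smul Γ (differentiableAt_of_planeField hσ) hg.differentiableAt }

theorem contDiff_christoffelForm (Γ : Fin 2 → Fin 2 → Fin 2 → ℝ) :
    ContDiff ℝ ∞ (christoffelForm Γ) := by
  let L : Plane →ₗ[ℝ] (Plane →L[ℝ] Plane) :=
    { toFun := christoffelForm Γ
      map_add' := christoffelForm_add Γ
      map_smul' := christoffelForm_smul Γ }
  exact (LinearMap.toContinuousLinearMap L).contDiff

/-- The connection with constant Christoffel symbols is smooth. -/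
theorem isSmoothConnection_christoffelConnection (Γ : Fin 2 → Fin 2 → Fin 2 → ℝ) :
    IsSmoothConnection (christoffelConnection Γ) := by
  refine ⟨⟨fun {σ} hσ ↦ ?_⟩⟩
  have h1 : ContDiff ℝ ∞ (show Plane → Plane from σ) := by
    have := (contMDiff_vectorSpace_iff_contDiff (𝕜 := ℝ) (V := σ)).1 (contMDiffOn_univ.1 hσ)
    simpa using! this
  have h2 : ContDiff ℝ ∞ (christoffelDeriv Γ (show Plane → Plane from σ)) :=
    (h1.fderiv_right (by simp)).add ((contDiff_christoffelForm Γ).comp h1)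
  have h3 (x : Plane) := inTangentCoordinates_model_space (I := 𝓡 2) (I' := 𝓡 2) id id
    (christoffelDeriv Γ (show Plane → Plane from σ)) x
  intro x _
  rw [contMDiffWithinAt_hom_bundle]
  refine ⟨contMDiffWithinAt_id, ?_⟩
  exact ((h2.contMDiff.contMDiffAt (x := x)).contMDiffWithinAt (s := univ)).congr
    (fun y _ ↦ congrFun (h3 x) y) (congrFun (h3 x) x)

/-- The Christoffel symbols `Γ_{11}^1 = 1`, `Γ_{12}^1 = 2u`, `Γ_{22}^1 = v`, all others being `0`
(in particular `Γ_{21}^1 = 0`); here the indices `1, 2` are written `0, 1`. -/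
def modelSymbols (u v : ℝ) (i j k : Fin 2) : ℝ :=
  if k = 0 then !![1, 2 * u; 0, v] i j else 0

/-- The affine surface `ℝ²` with `Γ_{11}^1 = 1`, `Γ_{12}^1 = 2u`, `Γ_{22}^1 = v`. -/
def model (u v : ℝ) : Connection Plane := christoffelConnection (modelSymbols u v)

/-- The parameters `(u, v)` of the models in the classification: `(1, 0)`, and `(u, ±1)` with
`u > 0`. -/
def modelParameters : Set (ℝ × ℝ) :=
  {(1, 0)} ∪ {p | 0 < p.1 ∧ (p.2 = 1 ∨ p.2 = -1)}

end Models

end AffineSurface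

end

/-! In local coordinates a connection is a bilinear-map-valued function `G` (its Christoffel
symbols, see `Represents`), and `∇T = 0`, `∇R = 0` become differential equations for `G`. Write ∂₁,
∂₂ for the coordinate fields; component indices in the code are `0`, `1`.

In dimension two T(a,b) = τ(b)a − τ(a)b for a 1-form τ. If T is parallel, so is τ; hence dτ(a,b) =
τ(2T(a,b)) = 0, and locally τ = dF. Taking F as second coordinate gives T(∂₁,∂₂) = ∂₁. As its
differential is parallel, all symbols Γᵢⱼ² vanish, and the connection reduces to two 1-forms ωᵢ with
∇∂ᵢ = ωᵢ ⊗ ∂₁ and ω₂(∂₁) = ω₁(∂₂) + 2.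

Write R(∂₁,∂₂)∂ᵢ = cᵢ∂₁. Then ∇R = 0 says dcᵢ = c₁ωᵢ. For i = 1, the identity d² = 0 gives c₁ dω₁ =
0, while c₁ = dω₁(∂₁,∂₂); so c₁² = 0. Therefore ω₁ = dψ is exact on a convex set and c₂ = κ is
constant.

The model coordinates are (log y, z₂/u). The exponential of the first model coordinate turns the
nonlinear transformation law into the linear equation (∇dy)(s,t) = −2dy(s)dz₂(t) − κ y dz₂(s)dz₂(t).
Setting dy = e^ψ dz₁ + w dz₂ makes this a first order system for (y,w), whose integrability
conditions are exactly the torsion normalization and c₂ = κ (`exists_solution`). The resulting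
parameters satisfy κu² = v, which leaves v ∈ {0, 1, −1}, with u = 1 when v = 0
(`exists_model_coordinates`).

Uniqueness comes from T(∂₁,∂₂) = u∂₁ and R(∂₁,∂₂)∂₂ = v∂₁: a local isomorphism rescales (u,v) to
(ub, vb²), and the chosen parameters force b = 1 (`parameters_unique`). Connectedness makes the
nonvanishing of T and the parameters global, and translations make the models homogeneous. -/

noncomputable section

namespace AffineSurface

open Filter
open scoped Topology

/-! ### Connections, torsion and curvature on a vector space in terms of Christoffel symbols -/

section PlaneCalculus

variable {E : Type*} [NormedAddCommGroup E] [NormedSpace ℝ E]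

/-- The vector field `∇_X Y` on the plane, for the connection `∇_a b = G(a, b)` on constant
fields `a`, `b`. -/
def planeNabla (G : E → E →L[ℝ] E →L[ℝ] E) (X Y : E → E) : E → E :=
  fun z ↦ fderiv ℝ Y z (X z) + G z (X z) (Y z)

/-- The torsion tensor of the connection with coefficients `G`. -/
def planeTorsion (G : E → E →L[ℝ] E →L[ℝ] E) (z a b : E) : E :=
  (1 / 2 : ℝ) • (G z a b - G z b a)

/-- The curvature tensor of the connection with coefficients `G`. -/
def planeCurvature (G : E → E →L[ℝ] E →L[ℝ] E) (z a b c : E) : E :=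
  fderiv ℝ G z a b c - fderiv ℝ G z b a c + G z a (G z b c) - G z b (G z a c)

variable {G : E → E →L[ℝ] E →L[ℝ] E} {X Y Z : E → E} {z : E}

theorem hasFDerivAt_planeNabla (hG : DifferentiableAt ℝ G z) (hX : DifferentiableAt ℝ X z)
    (hY : ContDiffAt ℝ 2 Y z) (v : E) :
    fderiv ℝ (planeNabla G X Y) z v =
      fderiv ℝ (fderiv ℝ Y) z v (X z) + fderiv ℝ Y z (fderiv ℝ X z v) +
        (fderiv ℝ G z v (X z) (Y z) + G z (fderiv ℝ X z v) (Y z) + G z (X z) (fderiv ℝ Y z v)) := by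
  have hY1 : DifferentiableAt ℝ Y z := hY.differentiableAt (by simp)
  have hdY : DifferentiableAt ℝ (fderiv ℝ Y) z :=
    (hY.fderiv_right (m := 1) (by norm_num)).differentiableAt (by simp)
  have h1 := hdY.hasFDerivAt.clm_apply hX.hasFDerivAt
  have h2 := (hG.hasFDerivAt.clm_apply hX.hasFDerivAt).clm_apply hY1.hasFDerivAt
  have h := (h1.add h2).fderiv
  have h' : planeNabla G X Y = (fun y ↦ fderiv ℝ Y y (X y)) + fun y ↦ G y (X y) (Y y) := rfl
  rw [h', h]
  simp
  abel

theorem planeNabla_contDiffAt {n : WithTop ℕ∞} (hG : ContDiffAt ℝ n G z) (hX : ContDiffAt ℝ n X z)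
    (hY : ContDiffAt ℝ (n + 1) Y z) : ContDiffAt ℝ n (planeNabla G X Y) z :=
  ((hY.fderiv_right (m := n) le_rfl).clm_apply hX).add
    ((hG.clm_apply hX).clm_apply (hY.of_le le_self_add))

theorem planeTorsion_contDiffAt {n : WithTop ℕ∞} (hG : ContDiffAt ℝ n G z) (hX : ContDiffAt ℝ n X z)
    (hY : ContDiffAt ℝ n Y z) : ContDiffAt ℝ n (fun y ↦ planeTorsion G y (X y) (Y y)) z :=
  (((hG.clm_apply hX).clm_apply hY).sub ((hG.clm_apply hY).clm_apply hX)).const_smul _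

theorem _root_.ContDiffAt.fderiv_clm_apply {F₁ F₂ : Type*} [NormedAddCommGroup F₁]
    [NormedSpace ℝ F₁] [NormedAddCommGroup F₂] [NormedSpace ℝ F₂] {L : E → F₁ →L[ℝ] F₂} {Y : E → F₁}
    {n : WithTop ℕ∞} (hL : ContDiffAt ℝ (n + 1) L z) (hX : ContDiffAt ℝ n X z)
    (hY : ContDiffAt ℝ n Y z) : ContDiffAt ℝ n (fun y ↦ fderiv ℝ L y (X y) (Y y)) z :=
  ((hL.fderiv_right (m := n) le_rfl).clm_apply hX).clm_apply hY

theorem planeCurvature_contDiffAt {n : WithTop ℕ∞} (hG : ContDiffAt ℝ (n + 1) G z)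
    (hX : ContDiffAt ℝ n X z) (hY : ContDiffAt ℝ n Y z) (hZ : ContDiffAt ℝ n Z z) :
    ContDiffAt ℝ n (fun y ↦ planeCurvature G y (X y) (Y y) (Z y)) z := by
  have hG' : ContDiffAt ℝ n G z := hG.of_le le_self_add
  exact ((((hG.fderiv_clm_apply hX hY).clm_apply hZ).sub
    ((hG.fderiv_clm_apply hY hX).clm_apply hZ)).add
    ((hG'.clm_apply hX).clm_apply ((hG'.clm_apply hY).clm_apply hZ))).sub
    ((hG'.clm_apply hY).clm_apply ((hG'.clm_apply hX).clm_apply hZ))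

theorem planeNabla_torsion_eq (X Y : E → E) (z : E) :
    (1 / 2 : ℝ) • (planeNabla G X Y z - planeNabla G Y X z - lieBracket ℝ X Y z) =
      planeTorsion G z (X z) (Y z) := by
  simp only [planeNabla, planeTorsion, lieBracket]
  congr 1
  abel

/-- Second derivatives of Z cancel by symmetry, and the first derivatives of X and Y are absorbed by
the bracket term; what remains is tensorial. -/
theorem planeNabla_curvature_eq (hG : DifferentiableAt ℝ G z) (hX : ContDiffAt ℝ 2 X z)
    (hY : ContDiffAt ℝ 2 Y z) (hZ : ContDiffAt ℝ 2 Z z) :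
    planeNabla G X (planeNabla G Y Z) z - planeNabla G Y (planeNabla G X Z) z -
      planeNabla G (lieBracket ℝ X Y) Z z = planeCurvature G z (X z) (Y z) (Z z) := by
  have hX1 : DifferentiableAt ℝ X z := hX.differentiableAt (by simp)
  have hY1 : DifferentiableAt ℝ Y z := hY.differentiableAt (by simp)
  have hsymm : fderiv ℝ (fderiv ℝ Z) z (X z) (Y z) = fderiv ℝ (fderiv ℝ Z) z (Y z) (X z) :=
    hZ.isSymmSndFDerivAt (by simp) _ _
  have e1 : planeNabla G X (planeNabla G Y Z) z =
    fderiv ℝ (planeNabla G Y Z) z (X z) + G z (X z) (fderiv ℝ Z z (Y z) + G z (Y z) (Z z)) := rfl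
  have e2 : planeNabla G Y (planeNabla G X Z) z =
    fderiv ℝ (planeNabla G X Z) z (Y z) + G z (Y z) (fderiv ℝ Z z (X z) + G z (X z) (Z z)) := rfl
  have e3 : planeNabla G (lieBracket ℝ X Y) Z z =
    fderiv ℝ Z z (fderiv ℝ Y z (X z) - fderiv ℝ X z (Y z)) +
      G z (fderiv ℝ Y z (X z) - fderiv ℝ X z (Y z)) (Z z) := rfl
  rw [e1, e2, e3, hasFDerivAt_planeNabla hG hY1 hZ, hasFDerivAt_planeNabla hG hX1 hZ, hsymm]
  simp only [planeCurvature, map_add, map_sub, sub_apply]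
  abel

end PlaneCalculus

/-! ### Transport of vector fields through local coordinates -/

section Transport

theorem two_le_infty : (2 : WithTop ℕ∞) ≤ ∞ := by
  change ((2 : ℕ∞) : WithTop ℕ∞) ≤ ((⊤ : ℕ∞) : WithTop ℕ∞)
  exact WithTop.coe_le_coe.2 le_top

theorem mlieBracket_plane (V W : Π z : Plane, TangentSpace (𝓡 2) z) :
    mlieBracket (𝓡 2) V W = lieBracket ℝ V W :=
  mlieBracketWithin_univ.symm.trans
    (mlieBracketWithin_eq_lieBracketWithin.trans lieBracketWithin_univ)

/-- Local coordinates on a surface: a smooth diffeomorphism between an open set and an open subset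
of the plane. -/
abbrev Coordinates (M : Type*) [TopologicalSpace M] [ChartedSpace Plane M] : Type _ :=
  PartialDiffeomorph (𝓡 2) (𝓡 2) M Plane ∞

variable {M : Type*} [TopologicalSpace M] [ChartedSpace Plane M]

/-- The differential of local coordinates. -/
def Coordinates.d (φ : Coordinates M) (x : M) : TangentSpace (𝓡 2) x →L[ℝ] Plane :=
  mfderiv (𝓡 2) (𝓡 2) φ x

/-- The vector field with components `X` in given local coordinates. -/
def Coordinates.pull (φ : Coordinates M) (X : Plane → Plane) : Π x : M, TangentSpace (𝓡 2) x :=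
  fun x ↦ (φ.d x).inverse (X (φ x))

/-- The components of a vector field in given local coordinates. -/
def Coordinates.push (φ : Coordinates M) (Y : Π x : M, TangentSpace (𝓡 2) x) : Plane → Plane :=
  fun z ↦ φ.d (φ.symm z) (Y (φ.symm z))

namespace Coordinates

variable (φ : Coordinates M) {X Y Z : Plane → Plane} {x : M}

theorem contMDiffAt (hx : x ∈ φ.source) : ContMDiffAt (𝓡 2) (𝓡 2) ∞ φ x :=
  φ.contMDiffOn.contMDiffAt (φ.open_source.mem_nhds hx)

theorem contMDiffAt_symm {z : Plane} (hz : z ∈ φ.target) :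
    ContMDiffAt (𝓡 2) (𝓡 2) ∞ φ.symm z :=
  φ.symm.contMDiffOn.contMDiffAt (φ.open_target.mem_nhds hz)

theorem isInvertible_d (hx : x ∈ φ.source) : (φ.d x).IsInvertible :=
  ⟨(φ.isLocalDiffeomorphAt _ _ _ hx).mfderivToContinuousLinearEquiv (by simp), rfl⟩

theorem mapsTo (hx : x ∈ φ.source) : φ x ∈ φ.target := φ.map_source hx

theorem mapsTo_symm {z : Plane} (hz : z ∈ φ.target) : φ.symm z ∈ φ.source := φ.map_target hz

theorem apply_symm {z : Plane} (hz : z ∈ φ.target) : φ (φ.symm z) = z := φ.right_inv hz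

theorem symm_apply (hx : x ∈ φ.source) : φ.symm (φ x) = x := φ.left_inv hx

theorem d_pull (hx : x ∈ φ.source) (X : Plane → Plane) : φ.d x (φ.pull X x) = X (φ x) := by
  obtain ⟨e, he⟩ := φ.isInvertible_d hx
  simp only [pull, ← he, ContinuousLinearMap.inverse_equiv]
  exact e.apply_symm_apply _

theorem d_injective (hx : x ∈ φ.source) : Function.Injective (φ.d x) := by
  obtain ⟨e, he⟩ := φ.isInvertible_d hx
  rw [← he]
  exact e.injective

theorem pull_eq_iff (hx : x ∈ φ.source) {v : TangentSpace (𝓡 2) x} :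
    φ.pull X x = v ↔ X (φ x) = φ.d x v := by
  rw [← φ.d_pull hx X]
  exact (φ.d_injective hx).eq_iff.symm

theorem pull_push (hx : x ∈ φ.source) (Y : Π x : M, TangentSpace (𝓡 2) x) :
    φ.pull (φ.push Y) x = Y x := by
  rw [φ.pull_eq_iff hx, push, φ.symm_apply hx]

theorem pull_apply_congr (h : X (φ x) = Y (φ x)) : φ.pull X x = φ.pull Y x :=
  congrArg (φ.d x).inverse h

theorem contDiffAt_planeField {n : WithTop ℕ∞} {z : Plane} :
    ContMDiffAt (𝓡 2) (𝓡 2).tangent n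
      (fun y ↦ (⟨y, X y⟩ : TangentBundle (𝓡 2) Plane)) z ↔ ContDiffAt ℝ n X z :=
  contMDiffAt_vectorSpace_iff_contDiffAt (V := fun z ↦ (X z : TangentSpace (𝓡 2) z))

theorem mdifferentiableAt_planeField {z : Plane} (hX : DifferentiableAt ℝ X z) :
    MDifferentiableAt (𝓡 2) (𝓡 2).tangent
      (fun y ↦ (⟨y, X y⟩ : TangentBundle (𝓡 2) Plane)) z := by
  refine (mdifferentiableAt_section (IB := 𝓡 2) (F := Plane)
    (E := (TangentSpace (𝓡 2) : Plane → Type _))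
    (fun y ↦ (X y : TangentSpace (𝓡 2) y)) (b₀ := z)).2 ?_
  have h' : (fun b ↦ (trivializationAt Plane (TangentSpace (𝓡 2)) z
      (⟨b, X b⟩ : TangentBundle (𝓡 2) Plane)).2) = X := by
    funext b
    simp
  rw [← mdifferentiableAt_iff_differentiableAt] at hX
  exact cast (congrArg (fun f : Plane → Plane ↦ MDifferentiableAt (𝓡 2) (𝓡 2) f z) h'.symm) hX

theorem isInvertible_mfderiv_symm {z : Plane} (hz : z ∈ φ.target) :
    (mfderiv (𝓡 2) (𝓡 2) φ.symm z).IsInvertible :=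
  ⟨(φ.symm.isLocalDiffeomorphAt (𝓡 2) (𝓡 2) ∞ hz).mfderivToContinuousLinearEquiv (by simp), rfl⟩

theorem d_mfderiv_symm {z : Plane} (hz : z ∈ φ.target) (v : TangentSpace (𝓡 2) z) :
    φ.d (φ.symm z) (mfderiv (𝓡 2) (𝓡 2) φ.symm z v) = v := by
  have h := mfderiv_comp_apply z ((φ.contMDiffAt (φ.mapsTo_symm hz)).mdifferentiableAt (by simp))
    ((φ.contMDiffAt_symm hz).mdifferentiableAt (by simp)) v
  have h' : φ ∘ φ.symm =ᶠ[𝓝 z] id := by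
    filter_upwards [φ.open_target.mem_nhds hz] with w hw using φ.apply_symm hw
  rw [h'.mfderiv_eq, mfderiv_id] at h
  exact h.symm

theorem inverse_mfderiv_symm_apply {z : Plane} (hz : z ∈ φ.target)
    (w : TangentSpace (𝓡 2) (φ.symm z)) :
    (mfderiv (𝓡 2) (𝓡 2) φ.symm z).inverse w = φ.d (φ.symm z) w :=
  (φ.isInvertible_mfderiv_symm hz).inverse_apply_eq.2
    (φ.d_injective (φ.mapsTo_symm hz) (φ.d_mfderiv_symm hz _).symm)

variable [IsManifold (𝓡 2) ∞ M]

/-- `φ.pull X` is by definition the pullback `mpullback` of X under φ, so the general regularity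
results for pullbacks apply. -/
theorem contMDiffAt_pull (hx : x ∈ φ.source) (hX : ContDiffAt ℝ ∞ X (φ x)) :
    ContMDiffAt (𝓡 2) (𝓡 2).tangent ∞
      (fun y ↦ (⟨y, φ.pull X y⟩ : TangentBundle (𝓡 2) M)) x :=
  have : IsManifold (𝓡 2) 1 M := .of_le (n := ∞) (one_le_two.trans two_le_infty)
  ContMDiffAt.mpullback_vectorField_preimage (n := ∞) (contDiffAt_planeField.2 hX)
    (φ.contMDiffAt hx) (φ.isInvertible_d hx) (by simp)

theorem mdifferentiableAt_pull (hx : x ∈ φ.source) (hX : DifferentiableAt ℝ X (φ x)) :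
    MDifferentiableAt (𝓡 2) (𝓡 2).tangent
      (fun y ↦ (⟨y, φ.pull X y⟩ : TangentBundle (𝓡 2) M)) x :=
  have : IsManifold (𝓡 2) 2 M := .of_le (n := ∞) two_le_infty
  MDifferentiableAt.mpullback_vectorField (n := ∞) (mdifferentiableAt_planeField hX)
    (φ.contMDiffAt hx) (φ.isInvertible_d hx) two_le_infty

/-- On the target, pushing forward by φ is pulling back by `φ.symm`, which reduces this to
regularity of pullbacks. -/
theorem contDiffAt_push (hx : x ∈ φ.source) {Y : Π x : M, TangentSpace (𝓡 2) x}
    (hY : ContMDiffAt (𝓡 2) (𝓡 2).tangent ∞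
      (fun y ↦ (⟨y, Y y⟩ : TangentBundle (𝓡 2) M)) x) :
    ContDiffAt ℝ ∞ (φ.push Y) (φ x) := by
  have : IsManifold (𝓡 2) 1 M := .of_le (n := ∞) (one_le_two.trans two_le_infty)
  have hz : φ x ∈ φ.target := φ.mapsTo hx
  rw [← φ.symm_apply hx] at hY
  have h := ContMDiffAt.mpullback_vectorField_preimage (n := ∞) (m := ∞) hY
    (φ.contMDiffAt_symm hz) (φ.isInvertible_mfderiv_symm hz) (by simp)
  refine (contDiffAt_planeField.1 h).congr_of_eventuallyEq ?_
  filter_upwards [φ.open_target.mem_nhds hz] with z hz'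
  exact (φ.inverse_mfderiv_symm_apply hz' _).symm

theorem mlieBracket_pull (hx : x ∈ φ.source) (hX : DifferentiableAt ℝ X (φ x))
    (hY : DifferentiableAt ℝ Y (φ x)) :
    mlieBracket (𝓡 2) (φ.pull X) (φ.pull Y) x = φ.pull (lieBracket ℝ X Y) x := by
  have : IsManifold (𝓡 2) 2 M := .of_le (n := ∞) two_le_infty
  have : IsManifold (𝓡 2) (minSmoothness ℝ 2) M := by simpa
  have h := mpullback_mlieBracket (n := ∞) (mdifferentiableAt_planeField hX)
    (mdifferentiableAt_planeField hY) (φ.contMDiffAt hx) (by simpa using two_le_infty)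
  exact h.symm.trans (congrFun (congrArg φ.pull (mlieBracket_plane _ _)) x)

end Coordinates

end Transport

/-! ### Christoffel symbols of a connection in coordinates -/

section Representation

variable {M : Type*} [TopologicalSpace M] [ChartedSpace Plane M] [IsManifold (𝓡 2) ∞ M]

/-- The vector field `X` is smooth near the point `x`. -/
def IsSmoothFieldAt (X : Π x : M, TangentSpace (𝓡 2) x) (x : M) : Prop :=
  ContMDiffAt (𝓡 2) (𝓡 2).tangent ∞ (fun y ↦ (⟨y, X y⟩ : TangentBundle (𝓡 2) M)) x

theorem IsSmoothField.isSmoothFieldAt {X : Π x : M, TangentSpace (𝓡 2) x} (hX : IsSmoothField X)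
    (x : M) : IsSmoothFieldAt X x := hX x

theorem IsSmoothFieldAt.mdifferentiableAt {X : Π x : M, TangentSpace (𝓡 2) x} {x : M}
    (hX : IsSmoothFieldAt X x) : MDifferentiableAt (𝓡 2) (𝓡 2).tangent
      (fun y ↦ (⟨y, X y⟩ : TangentBundle (𝓡 2) M)) x :=
  ContMDiffAt.mdifferentiableAt hX (by simp)

theorem IsSmoothFieldAt.congr {X X' : Π x : M, TangentSpace (𝓡 2) x} {x : M}
    (hX : IsSmoothFieldAt X x) (h : X' =ᶠ[𝓝 x] X) : IsSmoothFieldAt X' x :=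
  ContMDiffAt.congr_of_eventuallyEq hX (h.mono fun y hy ↦ by simp only [hy])

theorem IsSmoothFieldAt.eventually {X : Π x : M, TangentSpace (𝓡 2) x} {x : M}
    (hX : IsSmoothFieldAt X x) : ∀ᶠ y in 𝓝 x, MDifferentiableAt (𝓡 2) (𝓡 2).tangent
      (fun y ↦ (⟨y, X y⟩ : TangentBundle (𝓡 2) M)) y := by
  have : IsManifold (𝓡 2) 1 M := .of_le (n := ∞) (one_le_two.trans two_le_infty)
  have h : ContMDiffAt (𝓡 2) (𝓡 2).tangent 1
      (fun y ↦ (⟨y, X y⟩ : TangentBundle (𝓡 2) M)) x :=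
    ContMDiffAt.of_le hX (one_le_two.trans two_le_infty)
  rw [contMDiffAt_iff_contMDiffAt_nhds (by simp)] at h
  exact h.mono fun y hy ↦ hy.mdifferentiableAt (by simp)

/-- The axioms of a covariant derivative constrain it only on differentiable sections, so locality
in Y needs Y to be smooth near x. No regularity of X is needed, ∇ being pointwise in X. -/
theorem nabla_congr (cov : Connection M) {X X' Y Y' : Π x : M, TangentSpace (𝓡 2) x} {x : M}
    (hX : X =ᶠ[𝓝 x] X') (hY : Y =ᶠ[𝓝 x] Y') (hs : IsSmoothFieldAt Y x) :
    nabla cov X Y =ᶠ[𝓝 x] nabla cov X' Y' := by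
  filter_upwards [hX, hs.eventually, (hs.congr hY.symm).eventually,
    eventually_eventually_nhds.2 hY] with y h1 h2 h3 h4
  rw [nabla, nabla, h1, cov.isCovariantDerivativeOn.congr_of_eventuallyEq h2 h3 univ_mem h4]

/-- Near each point of its domain, a coordinate field extends to a smooth field. -/
theorem Coordinates.exists_isSmoothField [T2Space M] (φ : Coordinates M) {x : M}
    (hx : x ∈ φ.source) (a : Plane) :
    ∃ X : Π x : M, TangentSpace (𝓡 2) x,
      IsSmoothField X ∧ X =ᶠ[𝓝 x] φ.pull fun _ ↦ a := by
  have : IsManifold (𝓡 2) 1 M := .of_le (n := ∞) (one_le_two.trans two_le_infty)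
  obtain ⟨f, -, hf⟩ := (SmoothBumpFunction.nhds_basis_tsupport (I := 𝓡 2) x).mem_iff.1
    (φ.open_source.mem_nhds hx)
  refine ⟨fun y ↦ f y • φ.pull (fun _ ↦ a) y, fun y ↦ ?_, ?_⟩
  · by_cases hy : y ∈ φ.source
    · exact ContMDiffAt.smul_section f.contMDiffAt (φ.contMDiffAt_pull hy contDiffAt_const)
    · have h0 : ∀ᶠ w in 𝓝 y, f w = 0 := by
        filter_upwards [(isClosed_tsupport f).isOpen_compl.mem_nhds fun h ↦ hy (hf h)] with w hw
        exact image_eq_zero_of_notMem_tsupport hw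
      refine ContMDiffAt.congr_of_eventuallyEq
        (contMDiffAt_zeroSection (n := ∞) (IB := 𝓡 2) ℝ
          (TangentSpace (𝓡 2) : M → Type _) (F := Plane)) ?_
      filter_upwards [h0] with w hw
      simp [hw, zeroSection]
  · filter_upwards [f.eventuallyEq_one] with y hy
    simp only [hy]
    exact one_smul ℝ _

/-- The map `G` gives the Christoffel symbols of the connection `cov` in the coordinates `φ`. -/
structure Represents (φ : Coordinates M) (cov : Connection M)
    (G : Plane → Plane →L[ℝ] Plane →L[ℝ] Plane) : Prop where
  contDiffOn : ContDiffOn ℝ ∞ G φ.target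
  d_cov : ∀ x ∈ φ.source, ∀ Y : Plane → Plane, DifferentiableAt ℝ Y (φ x) → ∀ v,
    φ.d x (cov (φ.pull Y) x v) = fderiv ℝ Y (φ x) (φ.d x v) + G (φ x) (φ.d x v) (Y (φ x))

omit [IsManifold (𝓡 2) ∞ M] in
theorem mvfderiv_comp_coordinates (φ : Coordinates M) {x : M} (hx : x ∈ φ.source)
    {g : Plane → ℝ} (hg : DifferentiableAt ℝ g (φ x)) (v : TangentSpace (𝓡 2) x) :
    mvfderiv (𝓡 2) (g ∘ φ) x v = fderiv ℝ g (φ x) (φ.d x v) := by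
  have h := mfderiv_comp_apply x hg.mdifferentiableAt
    ((φ.contMDiffAt hx).mdifferentiableAt (by simp)) v
  rw [mfderiv_eq_fderiv] at h
  exact h

theorem isSmoothField_nabla {cov : Connection M} (hcov : IsSmoothConnection cov)
    {X Y : Π x : M, TangentSpace (𝓡 2) x} (hX : IsSmoothField X) (hY : IsSmoothField Y) :
    IsSmoothField (nabla cov X Y) := by
  have : IsManifold (𝓡 2) 1 M := .of_le (n := ∞) (one_le_two.trans two_le_infty)
  have h := hcov.contMDiff.contMDiff (σ := Y) (contMDiffOn_univ.2 (by simpa using! hY))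
  exact (contMDiffOn_univ.1 h).clm_bundle_apply hX

omit [IsManifold (𝓡 2) ∞ M] in
theorem Coordinates.pull_eq (φ : Coordinates M) (Y : Plane → Plane) :
    φ.pull Y = ((fun z ↦ Y z 0) ∘ φ) • φ.pull (fun _ ↦ EuclideanSpace.single 0 1) +
      ((fun z ↦ Y z 1) ∘ φ) • φ.pull (fun _ ↦ EuclideanSpace.single 1 1) := by
  funext x
  have h : Y (φ x) = Y (φ x) 0 • EuclideanSpace.single 0 1 +
      Y (φ x) 1 • EuclideanSpace.single 1 1 := by
    ext i; fin_cases i <;> simp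
  change (φ.d x).inverse (Y (φ x)) = _
  rw [h, map_add, map_smul, map_smul]
  simp [pull]

/-- The Christoffel symbols of a connection in given coordinates. -/
def Coordinates.christoffel (φ : Coordinates M) (cov : Connection M) (z : Plane) :
    Plane →L[ℝ] Plane →L[ℝ] Plane :=
  ContinuousLinearMap.flip <| ∑ j : Fin 2,
    (EuclideanSpace.proj j : Plane →L[ℝ] ℝ).smulRight
      (φ.d (φ.symm z) ∘L cov (φ.pull fun _ ↦ EuclideanSpace.single j 1) (φ.symm z) ∘L
        (φ.d (φ.symm z)).inverse)

theorem Coordinates.christoffel_apply (φ : Coordinates M) (cov : Connection M) (z a b : Plane) :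
    φ.christoffel cov z a b = ∑ j, b j •
      φ.push (nabla cov (φ.pull fun _ ↦ a) (φ.pull fun _ ↦ EuclideanSpace.single j 1)) z := by
  simp only [christoffel, Fin.sum_univ_two, ContinuousLinearMap.flip_apply, add_apply]
  rfl

/-- The formula is the Leibniz rule applied to the expansion of Y in coordinate fields. The
Hausdorff assumption enters through the bump functions used for smoothness. -/
theorem represents_christoffel [T2Space M] (φ : Coordinates M) {cov : Connection M}
    (hcov : IsSmoothConnection cov) : Represents φ cov (φ.christoffel cov) where
  contDiffOn := by
    refine contDiffOn_clm_apply.2 fun a ↦ contDiffOn_clm_apply.2 fun b z hz ↦ ?_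
    refine ContDiffAt.contDiffWithinAt ?_
    simp only [Coordinates.christoffel_apply]
    refine ContDiffAt.sum fun j _ ↦ ContDiffAt.const_smul _ ?_
    have hx := φ.mapsTo_symm hz
    -- Coordinate fields are replaced near the point by globally smooth ones, to which
    -- `isSmoothField_nabla` applies.
    obtain ⟨X, hX, hX'⟩ := φ.exists_isSmoothField hx a
    obtain ⟨Y, hY, hY'⟩ := φ.exists_isSmoothField hx (EuclideanSpace.single j 1)
    have h := ((isSmoothField_nabla hcov hX hY).isSmoothFieldAt (φ.symm z)).congr
      (nabla_congr cov hX' hY' (hY.isSmoothFieldAt _)).symm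
    simpa only [φ.apply_symm hz] using φ.contDiffAt_push hx h
  d_cov x hx Y hY v := by
    have hY' (j : Fin 2) : DifferentiableAt ℝ (fun z ↦ Y z j) (φ x) :=
      (EuclideanSpace.proj j : Plane →L[ℝ] ℝ).differentiableAt.comp _ hY
    have hg (j : Fin 2) : MDifferentiableAt (𝓡 2) 𝓘(ℝ, ℝ) ((fun z ↦ Y z j) ∘ φ) x :=
      (hY' j).mdifferentiableAt.comp x ((φ.contMDiffAt hx).mdifferentiableAt (by simp))
    have hs (j : Fin 2) := φ.mdifferentiableAt_pull hx
      (differentiableAt_const (EuclideanSpace.single j (1 : ℝ) : Plane))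
    have hgs (j : Fin 2) := (hg j).smul_section (hs j)
    have hd (j : Fin 2) : fderiv ℝ (fun z ↦ Y z j) (φ x) (φ.d x v) =
        fderiv ℝ Y (φ x) (φ.d x v) j := by
      have := ((EuclideanSpace.proj j : Plane →L[ℝ] ℝ).hasFDerivAt.comp _ hY.hasFDerivAt).fderiv
      exact congrArg (fun L ↦ L (φ.d x v)) this
    have hv : (φ.d x).inverse (φ.d x v) = v :=
      (φ.pull_eq_iff (X := fun _ ↦ φ.d x v) hx).2 rfl
    have hc (j : Fin 2) : φ.push (nabla cov (φ.pull fun _ ↦ φ.d x v)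
        (φ.pull fun _ ↦ EuclideanSpace.single j 1)) (φ x) =
        φ.d x (cov (φ.pull fun _ ↦ EuclideanSpace.single j 1) x v) := by
      rw [Coordinates.push, φ.symm_apply hx, nabla]
      exact congrArg _ (congrArg _ hv)
    rw [φ.pull_eq Y, cov.isCovariantDerivativeOnUniv.add (hgs 0) (hgs 1),
      cov.isCovariantDerivativeOnUniv.leibniz (hs 0) (hg 0),
      cov.isCovariantDerivativeOnUniv.leibniz (hs 1) (hg 1), Coordinates.christoffel_apply,
      Fin.sum_univ_two, hc, hc]
    have key (j : Fin 2) : φ.d x ((((fun z ↦ Y z j) ∘ φ) x • cov (φ.pull fun _ ↦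
        EuclideanSpace.single j 1) x + (mvfderiv (𝓡 2) ((fun z ↦ Y z j) ∘ φ) x).smulRight
          (φ.pull (fun _ ↦ EuclideanSpace.single j 1) x)) v) =
        Y (φ x) j • φ.d x (cov (φ.pull fun _ ↦ EuclideanSpace.single j 1) x v) +
          fderiv ℝ Y (φ x) (φ.d x v) j • EuclideanSpace.single j 1 := by
      have e : ((((fun z ↦ Y z j) ∘ φ) x • cov (φ.pull fun _ ↦
        EuclideanSpace.single j 1) x + (mvfderiv (𝓡 2) ((fun z ↦ Y z j) ∘ φ) x).smulRight
          (φ.pull (fun _ ↦ EuclideanSpace.single j 1) x)) v) =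
          Y (φ x) j • cov (φ.pull fun _ ↦ EuclideanSpace.single j 1) x v +
          mvfderiv (𝓡 2) ((fun z ↦ Y z j) ∘ φ) x v •
            φ.pull (fun _ ↦ EuclideanSpace.single j 1) x := rfl
      rw [e, map_add, map_smul, map_smul, φ.d_pull hx, mvfderiv_comp_coordinates φ hx (hY' j), hd]
    have hbasis : fderiv ℝ Y (φ x) (φ.d x v) =
        fderiv ℝ Y (φ x) (φ.d x v) 0 • EuclideanSpace.single 0 1 +
          fderiv ℝ Y (φ x) (φ.d x v) 1 • EuclideanSpace.single 1 1 := by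
      ext i; fin_cases i <;> simp
    rw [add_apply, map_add, key, key]
    conv_rhs => rw [hbasis]
    abel

end Representation

/-! ### Torsion, curvature and the parallelism equations in coordinates -/

section Representation

variable {M : Type*} [TopologicalSpace M] [ChartedSpace Plane M] [IsManifold (𝓡 2) ∞ M]
  {φ : Coordinates M} {cov : Connection M} {G : Plane → Plane →L[ℝ] Plane →L[ℝ] Plane} {x : M}

theorem curvature_congr (cov : Connection M) {X X' Y Y' Z Z' : Π x : M, TangentSpace (𝓡 2) x}
    (hX : X =ᶠ[𝓝 x] X') (hY : Y =ᶠ[𝓝 x] Y') (hZ : Z =ᶠ[𝓝 x] Z') (hs : IsSmoothFieldAt Z x)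
    (hYZ : IsSmoothFieldAt (nabla cov Y Z) x) (hXZ : IsSmoothFieldAt (nabla cov X Z) x) :
    curvature cov X Y Z =ᶠ[𝓝 x] curvature cov X' Y' Z' :=
  ((nabla_congr cov hX (nabla_congr cov hY hZ hs) hYZ).sub
    (nabla_congr cov hY (nabla_congr cov hX hZ hs) hXZ)).sub
    (nabla_congr cov (hX.mlieBracket_vectorField hY) hZ hs)

theorem torsion_congr (cov : Connection M) {X X' Y Y' : Π x : M, TangentSpace (𝓡 2) x}
    (hX : X =ᶠ[𝓝 x] X') (hY : Y =ᶠ[𝓝 x] Y') (hsX : IsSmoothFieldAt X x)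
    (hsY : IsSmoothFieldAt Y x) : torsion cov X Y =ᶠ[𝓝 x] torsion cov X' Y' :=
  (((nabla_congr cov hX hY hsY).sub (nabla_congr cov hY hX hsX)).sub
    (hX.mlieBracket_vectorField hY)).const_smul _

theorem _root_.ContDiffAt.eventually_contDiffAt_two {X : Plane → Plane} {z : Plane}
    (hX : ContDiffAt ℝ ∞ X z) : ∀ᶠ y in 𝓝 z, ContDiffAt ℝ 2 X y :=
  (hX.of_le two_le_infty).eventually (by simp)

omit [IsManifold (𝓡 2) ∞ M] in
theorem Coordinates.pull_push_eventuallyEq (φ : Coordinates M) (hx : x ∈ φ.source)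
    (Y : Π x : M, TangentSpace (𝓡 2) x) : φ.pull (φ.push Y) =ᶠ[𝓝 x] Y := by
  filter_upwards [φ.open_source.mem_nhds hx] with y hy using φ.pull_push hy Y

omit [IsManifold (𝓡 2) ∞ M] in
theorem Coordinates.pull_sub (φ : Coordinates M) (X Y : Plane → Plane) :
    φ.pull (X - Y) = φ.pull X - φ.pull Y :=
  funext fun _ ↦ map_sub _ _ _

omit [IsManifold (𝓡 2) ∞ M] in
theorem Coordinates.eventually_mem_source (φ : Coordinates M) (hx : x ∈ φ.source)
    {p : Plane → Prop} (h : ∀ᶠ z in 𝓝 (φ x), p z) : ∀ᶠ y in 𝓝 x, y ∈ φ.source ∧ p (φ y) :=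
  Eventually.and (φ.open_source.mem_nhds hx) ((φ.contMDiffAt hx).continuousAt.eventually h)

omit [IsManifold (𝓡 2) ∞ M] in
theorem Coordinates.push_apply (φ : Coordinates M) (hx : x ∈ φ.source)
    (Y : Π x : M, TangentSpace (𝓡 2) x) : φ.push Y (φ x) = φ.d x (Y x) := by
  rw [push, φ.symm_apply hx]

namespace Represents

variable (hG : Represents φ cov G) (hx : x ∈ φ.source)
include hG

theorem contDiffAt {z : Plane} (hz : z ∈ φ.target) : ContDiffAt ℝ ∞ G z :=
  hG.contDiffOn.contDiffAt (φ.open_target.mem_nhds hz)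

theorem congr {G' : Plane → Plane →L[ℝ] Plane →L[ℝ] Plane}
    (h : EqOn G' G φ.target) : Represents φ cov G' where
  contDiffOn := hG.contDiffOn.congr h
  d_cov x hx Y hY v := by rw [hG.d_cov x hx Y hY, h (φ.mapsTo hx)]

include hx

theorem nabla_pull_apply (X : Plane → Plane) {Y : Plane → Plane}
    (hY : DifferentiableAt ℝ Y (φ x)) :
    nabla cov (φ.pull X) (φ.pull Y) x = φ.pull (planeNabla G X Y) x := by
  refine ((φ.pull_eq_iff hx).2 ?_).symm
  rw [nabla, hG.d_cov x hx Y hY, φ.d_pull hx, planeNabla]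

theorem nabla_pull (X : Plane → Plane) {Y : Plane → Plane} (hY : ContDiffAt ℝ ∞ Y (φ x)) :
    nabla cov (φ.pull X) (φ.pull Y) =ᶠ[𝓝 x] φ.pull (planeNabla G X Y) := by
  filter_upwards [φ.eventually_mem_source hx hY.eventually_contDiffAt_two] with y hy
  exact hG.nabla_pull_apply hy.1 X (hy.2.differentiableAt (by simp))

theorem torsion_pull {X Y : Plane → Plane} (hX : ContDiffAt ℝ ∞ X (φ x))
    (hY : ContDiffAt ℝ ∞ Y (φ x)) :
    torsion cov (φ.pull X) (φ.pull Y) =ᶠ[𝓝 x]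
      φ.pull fun z ↦ planeTorsion G z (X z) (Y z) := by
  filter_upwards [φ.eventually_mem_source hx hX.eventually_contDiffAt_two,
    φ.eventually_mem_source hx hY.eventually_contDiffAt_two] with y h1 h2
  have h1' := h1.2.differentiableAt (by simp)
  have h2' := h2.2.differentiableAt (by simp)
  have e : torsion cov (φ.pull X) (φ.pull Y) y = (1 / 2 : ℝ) •
    (nabla cov (φ.pull X) (φ.pull Y) y - nabla cov (φ.pull Y) (φ.pull X) y -
      mlieBracket (𝓡 2) (φ.pull X) (φ.pull Y) y) := rfl
  rw [e, hG.nabla_pull_apply h1.1 X h2', hG.nabla_pull_apply h1.1 Y h1',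
    φ.mlieBracket_pull h1.1 h1' h2']
  simp only [← planeNabla_torsion_eq]
  change _ = (φ.d y).inverse _
  rw [map_smul, map_sub, map_sub]
  rfl

theorem curvature_pull {X Y Z : Plane → Plane} (hX : ContDiffAt ℝ ∞ X (φ x))
    (hY : ContDiffAt ℝ ∞ Y (φ x)) (hZ : ContDiffAt ℝ ∞ Z (φ x)) :
    curvature cov (φ.pull X) (φ.pull Y) (φ.pull Z) =ᶠ[𝓝 x]
      φ.pull fun z ↦ planeCurvature G z (X z) (Y z) (Z z) := by
  have hGx := hG.contDiffAt (φ.mapsTo hx)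
  have hYZ := planeNabla_contDiffAt hGx hY hZ
  have hXZ := planeNabla_contDiffAt hGx hX hZ
  have n1 := (nabla_congr cov (EventuallyEq.refl _ (φ.pull X)) (hG.nabla_pull hx Y hZ).symm
    (φ.contMDiffAt_pull hx hYZ)).symm.trans (hG.nabla_pull hx X hYZ)
  have n2 := (nabla_congr cov (EventuallyEq.refl _ (φ.pull Y)) (hG.nabla_pull hx X hZ).symm
    (φ.contMDiffAt_pull hx hXZ)).symm.trans (hG.nabla_pull hx Y hXZ)
  have hb : mlieBracket (𝓡 2) (φ.pull X) (φ.pull Y) =ᶠ[𝓝 x] φ.pull (lieBracket ℝ X Y) := by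
    filter_upwards [φ.eventually_mem_source hx hX.eventually_contDiffAt_two,
      φ.eventually_mem_source hx hY.eventually_contDiffAt_two] with y h1 h2
    exact φ.mlieBracket_pull h1.1 (h1.2.differentiableAt (by simp))
      (h2.2.differentiableAt (by simp))
  have n3 := (nabla_congr cov hb (EventuallyEq.refl _ (φ.pull Z))
    (φ.contMDiffAt_pull hx hZ)).trans (hG.nabla_pull hx _ hZ)
  refine ((n1.sub n2).sub n3).trans ?_
  filter_upwards [φ.eventually_mem_source hx hX.eventually_contDiffAt_two,
    φ.eventually_mem_source hx hY.eventually_contDiffAt_two,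
    φ.eventually_mem_source hx hZ.eventually_contDiffAt_two] with y h1 h2 h3
  have h := planeNabla_curvature_eq ((hG.contDiffAt (φ.mapsTo h1.1)).differentiableAt (by simp))
    h1.2 h2.2 h3.2
  have e : φ.pull (planeNabla G X (planeNabla G Y Z) - planeNabla G Y (planeNabla G X Z) -
      planeNabla G (lieBracket ℝ X Y) Z) y =
      φ.pull (fun z ↦ planeCurvature G z (X z) (Y z) (Z z)) y := φ.pull_apply_congr h
  rw [φ.pull_sub, φ.pull_sub] at e
  exact e

theorem isSmoothFieldAt_nabla {X Y : Π x : M, TangentSpace (𝓡 2) x}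
    (hX : IsSmoothFieldAt X x) (hY : IsSmoothFieldAt Y x) : IsSmoothFieldAt (nabla cov X Y) x := by
  have hX' := φ.contDiffAt_push hx hX
  have hY' := φ.contDiffAt_push hx hY
  have h := (nabla_congr cov (φ.pull_push_eventuallyEq hx X) (φ.pull_push_eventuallyEq hx Y)
    (φ.contMDiffAt_pull hx hY')).symm.trans (hG.nabla_pull hx (φ.push X) hY')
  exact IsSmoothFieldAt.congr
    (φ.contMDiffAt_pull hx (planeNabla_contDiffAt (hG.contDiffAt (φ.mapsTo hx)) hX' hY')) h

/-- In coordinates the torsion is given by the tensor `planeTorsion`. -/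
theorem d_torsion {X Y : Π x : M, TangentSpace (𝓡 2) x}
    (hX : IsSmoothFieldAt X x) (hY : IsSmoothFieldAt Y x) :
    φ.d x (torsion cov X Y x) = planeTorsion G (φ x) (φ.d x (X x)) (φ.d x (Y x)) := by
  have h := (torsion_congr cov (φ.pull_push_eventuallyEq hx X).symm
    (φ.pull_push_eventuallyEq hx Y).symm hX hY).trans
    (hG.torsion_pull hx (φ.contDiffAt_push hx hX) (φ.contDiffAt_push hx hY))
  rw [h.self_of_nhds, φ.d_pull hx, φ.push_apply hx, φ.push_apply hx]

/-- In coordinates the curvature is given by the tensor `planeCurvature`. -/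
theorem d_curvature {X Y Z : Π x : M, TangentSpace (𝓡 2) x}
    (hX : IsSmoothFieldAt X x) (hY : IsSmoothFieldAt Y x) (hZ : IsSmoothFieldAt Z x) :
    φ.d x (curvature cov X Y Z x) =
      planeCurvature G (φ x) (φ.d x (X x)) (φ.d x (Y x)) (φ.d x (Z x)) := by
  have h := (curvature_congr cov (φ.pull_push_eventuallyEq hx X).symm
    (φ.pull_push_eventuallyEq hx Y).symm (φ.pull_push_eventuallyEq hx Z).symm hZ
    (hG.isSmoothFieldAt_nabla hx hY hZ) (hG.isSmoothFieldAt_nabla hx hX hZ)).trans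
    (hG.curvature_pull hx (φ.contDiffAt_push hx hX) (φ.contDiffAt_push hx hY)
      (φ.contDiffAt_push hx hZ))
  rw [h.self_of_nhds, φ.d_pull hx, φ.push_apply hx, φ.push_apply hx, φ.push_apply hx]

theorem d_nabla_pull_const {X Y : Π x : M, TangentSpace (𝓡 2) x} {Y' : Plane → Plane} {a : Plane}
    (hX : X =ᶠ[𝓝 x] φ.pull fun _ ↦ a) (hY : Y =ᶠ[𝓝 x] φ.pull Y')
    (hY' : ContDiffAt ℝ ∞ Y' (φ x)) :
    φ.d x (nabla cov X Y x) = fderiv ℝ Y' (φ x) a + G (φ x) a (Y' (φ x)) := by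
  have h := nabla_congr cov hX hY ((φ.contMDiffAt_pull hx hY').congr_of_eventuallyEq
    (hY.mono fun y hy ↦ by simp only [hy]))
  rw [h.self_of_nhds, hG.nabla_pull_apply hx _ (hY'.differentiableAt (by simp)), φ.d_pull hx,
    planeNabla]

omit hx in
/-- The equation `∇T = 0` in coordinates. -/
theorem planeTorsion_parallel [T2Space M] (hT : HasParallelTorsion cov) {z : Plane}
    (hz : z ∈ φ.target) (w a b : Plane) :
    fderiv ℝ (fun y ↦ planeTorsion G y a b) z w + G z w (planeTorsion G z a b) =
      planeTorsion G z (G z w a) b + planeTorsion G z a (G z w b) := by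
  have hx := φ.mapsTo_symm hz
  obtain ⟨W, hW, hW'⟩ := φ.exists_isSmoothField hx w
  obtain ⟨X, hX, hX'⟩ := φ.exists_isSmoothField hx a
  obtain ⟨Y, hY, hY'⟩ := φ.exists_isSmoothField hx b
  have hz' := φ.apply_symm hz
  have hT' := (torsion_congr cov hX' hY' (hX _) (hY _)).trans
    (hG.torsion_pull hx contDiffAt_const contDiffAt_const)
  have h1 := hG.d_nabla_pull_const hx hW' hT' (planeTorsion_contDiffAt
    (hG.contDiffAt (φ.mapsTo hx)) contDiffAt_const contDiffAt_const)
  have h2 := hG.d_torsion hx (hG.isSmoothFieldAt_nabla hx (hW _) (hX _)) (hY _)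
  have h3 := hG.d_torsion hx (hX _) (hG.isSmoothFieldAt_nabla hx (hW _) (hY _))
  rw [hG.d_nabla_pull_const hx hW' hX' contDiffAt_const, hY'.self_of_nhds, φ.d_pull hx] at h2
  rw [hG.d_nabla_pull_const hx hW' hY' contDiffAt_const, hX'.self_of_nhds, φ.d_pull hx] at h3
  have h := congrArg (φ.d _) (congrFun (hT W X Y hW hX hY) (φ.symm z))
  simp only [Pi.sub_apply, map_sub, h1, h2, h3, Pi.zero_apply, map_zero, hz'] at h
  rw [sub_sub, sub_eq_zero] at h
  simpa using h

omit hx in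
/-- The equation `∇R = 0` in coordinates. -/
theorem planeCurvature_parallel [T2Space M] (hR : IsSymmetric cov) {z : Plane}
    (hz : z ∈ φ.target) (w a b c : Plane) :
    fderiv ℝ (fun y ↦ planeCurvature G y a b c) z w + G z w (planeCurvature G z a b c) =
      planeCurvature G z (G z w a) b c + planeCurvature G z a (G z w b) c +
        planeCurvature G z a b (G z w c) := by
  have hx := φ.mapsTo_symm hz
  obtain ⟨W, hW, hW'⟩ := φ.exists_isSmoothField hx w
  obtain ⟨X, hX, hX'⟩ := φ.exists_isSmoothField hx a
  obtain ⟨Y, hY, hY'⟩ := φ.exists_isSmoothField hx b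
  obtain ⟨Z, hZ, hZ'⟩ := φ.exists_isSmoothField hx c
  have hz' := φ.apply_symm hz
  have hsm {U V : Π x : M, TangentSpace (𝓡 2) x} (hU : IsSmoothField U) (hV : IsSmoothField V) :=
    hG.isSmoothFieldAt_nabla hx (hU _) (hV _)
  have hR' := (curvature_congr cov hX' hY' hZ' (hZ _) (hsm hY hZ) (hsm hX hZ)).trans
    (hG.curvature_pull hx contDiffAt_const contDiffAt_const contDiffAt_const)
  have h1 := hG.d_nabla_pull_const hx hW' hR' (planeCurvature_contDiffAt
    (hG.contDiffAt (φ.mapsTo hx)) contDiffAt_const contDiffAt_const contDiffAt_const)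
  have h2 := hG.d_curvature hx (hsm hW hX) (hY _) (hZ _)
  have h3 := hG.d_curvature hx (hX _) (hsm hW hY) (hZ _)
  have h4 := hG.d_curvature hx (hX _) (hY _) (hsm hW hZ)
  rw [hG.d_nabla_pull_const hx hW' hX' contDiffAt_const, hY'.self_of_nhds, hZ'.self_of_nhds,
    φ.d_pull hx, φ.d_pull hx] at h2
  rw [hG.d_nabla_pull_const hx hW' hY' contDiffAt_const, hX'.self_of_nhds, hZ'.self_of_nhds,
    φ.d_pull hx, φ.d_pull hx] at h3
  rw [hG.d_nabla_pull_const hx hW' hZ' contDiffAt_const, hX'.self_of_nhds, hY'.self_of_nhds,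
    φ.d_pull hx, φ.d_pull hx] at h4
  have h := congrArg (φ.d _) (congrFun (hR W X Y Z hW hX hY hZ) (φ.symm z))
  simp only [Pi.sub_apply, map_sub, h1, h2, h3, h4, Pi.zero_apply, map_zero, hz'] at h
  rw [sub_sub, sub_sub, sub_eq_zero] at h
  simpa [add_assoc] using h

end Represents

/-- The constant Christoffel symbols `Γ` as a bilinear map. -/
def christoffelBilin (Γ : Fin 2 → Fin 2 → Fin 2 → ℝ) : Plane →L[ℝ] Plane →L[ℝ] Plane :=
  ContinuousLinearMap.flip <| LinearMap.toContinuousLinearMap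
    { toFun := christoffelForm Γ
      map_add' := christoffelForm_add Γ
      map_smul' := christoffelForm_smul Γ }

theorem christoffelBilin_apply (Γ : Fin 2 → Fin 2 → Fin 2 → ℝ) (a b : Plane) :
    christoffelBilin Γ a b = christoffelForm Γ b a := rfl

/-- Being affine onto a constant-symbol model means having those constants as Christoffel symbols;
this and `IsLocalAffineIso.represents` translate between the two. -/
theorem Represents.isLocalAffineIso {Γ : Fin 2 → Fin 2 → Fin 2 → ℝ}
    (h : Represents φ cov fun _ ↦ christoffelBilin Γ) :
    IsLocalAffineIso cov (christoffelConnection Γ) φ := by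
  intro X Y hX hY x hx
  have hY' : ContDiffAt ℝ ∞ (Y : Plane → Plane) (φ x) :=
    Coordinates.contDiffAt_planeField.1 (hY (φ x))
  have h' := congrArg (φ.d x) (h.nabla_pull_apply hx X (hY'.differentiableAt (by simp)))
  rw [φ.d_pull hx] at h'
  exact h'

/-- Testing the intertwining relation on constant fields of the plane, whose derivatives vanish,
reads off the symbols. -/
theorem IsLocalAffineIso.represents [T2Space M] (hcov : IsSmoothConnection cov)
    {Γ : Fin 2 → Fin 2 → Fin 2 → ℝ} (h : IsLocalAffineIso cov (christoffelConnection Γ) φ) :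
    Represents φ cov fun _ ↦ christoffelBilin Γ := by
  have hG := represents_christoffel φ hcov
  refine hG.congr fun z hz ↦ ContinuousLinearMap.ext fun a ↦ ContinuousLinearMap.ext fun b ↦ ?_
  have hx := φ.mapsTo_symm hz
  have hs (c : Plane) : IsSmoothField fun z ↦ (c : TangentSpace (𝓡 2) z) := fun z ↦
    Coordinates.contDiffAt_planeField.2 contDiffAt_const
  have h1 := h _ _ (hs a) (hs b) _ hx
  have h2 := hG.d_nabla_pull_const hx (EventuallyEq.refl _ (φ.pull fun _ ↦ a))
    (EventuallyEq.refl _ (φ.pull fun _ ↦ b)) contDiffAt_const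
  have h3 := h1.symm.trans h2
  have h4 : nabla (christoffelConnection Γ) (fun _ ↦ a) (fun _ ↦ b) (φ (φ.symm z)) =
    fderiv ℝ (fun _ : Plane ↦ b) (φ (φ.symm z)) a + christoffelBilin Γ a b := rfl
  have h5 := h4.symm.trans h3
  rw [φ.apply_symm hz] at h5
  simpa using! h5

end Representation

/-! ### The models: homogeneity, Ricci tensor, inequivalence -/

section Models

theorem christoffelBilin_modelSymbols_zero (u v : ℝ) (a b : Plane) :
    christoffelBilin (modelSymbols u v) a b 0 = a 0 * b 0 + 2 * u * a 0 * b 1 + v * a 1 * b 1 := by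
  rw [christoffelBilin_apply, christoffelForm_apply]
  simp [modelSymbols, Fin.sum_univ_two]

theorem christoffelBilin_modelSymbols_one (u v : ℝ) (a b : Plane) :
    christoffelBilin (modelSymbols u v) a b 1 = 0 := by
  rw [christoffelBilin_apply, christoffelForm_apply]
  simp [modelSymbols]

theorem planeTorsion_model (u v : ℝ) (z a b : Plane) :
    planeTorsion (fun _ ↦ christoffelBilin (modelSymbols u v)) z a b =
      EuclideanSpace.single 0 (u * (a 0 * b 1 - a 1 * b 0)) := by
  ext k
  fin_cases k
  · simp [planeTorsion, christoffelBilin_modelSymbols_zero]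
    ring
  · simp [planeTorsion, christoffelBilin_modelSymbols_one]

theorem planeCurvature_model (u v : ℝ) (z a b c : Plane) :
    planeCurvature (fun _ ↦ christoffelBilin (modelSymbols u v)) z a b c =
      EuclideanSpace.single 0 (v * c 1 * (a 0 * b 1 - a 1 * b 0)) := by
  ext k
  fin_cases k
  · simp [planeCurvature, christoffelBilin_modelSymbols_zero, christoffelBilin_modelSymbols_one]
    ring
  · simp [planeCurvature, christoffelBilin_modelSymbols_one]

/-- The translation by `c` as a diffeomorphism of the plane. -/
def translation (c : Plane) : Diffeomorph (𝓡 2) (𝓡 2) Plane Plane ∞ where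
  toEquiv := Equiv.addRight c
  contMDiff_toFun := (contDiff_id.add contDiff_const).contMDiff
  contMDiff_invFun := (contDiff_id.add contDiff_const).contMDiff

/-- The translation by `c` as coordinates on the plane. -/
def translationCoordinates (c : Plane) : Coordinates Plane :=
  (translation c).toPartialDiffeomorph

theorem translationCoordinates_d (c x : Plane) (v : TangentSpace (𝓡 2) x) :
    (translationCoordinates c).d x v = v := by
  have h : mfderiv (𝓡 2) (𝓡 2) (fun y : Plane ↦ y + c) x = fderiv ℝ (fun y : Plane ↦ y + c) x :=
    mfderiv_eq_fderiv
  have h' := congrArg (fun L ↦ L v) h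
  rw [fderiv_add_const, fderiv_fun_id] at h'
  exact h'

theorem translationCoordinates_pull (c : Plane) (X : Plane → Plane) (x : Plane) :
    (translationCoordinates c).pull X x = X (x + c) :=
  ((translationCoordinates c).pull_eq_iff (mem_univ x)).2 (translationCoordinates_d c x _).symm

theorem represents_translationCoordinates (Γ : Fin 2 → Fin 2 → Fin 2 → ℝ) (c : Plane) :
    Represents (translationCoordinates c) (christoffelConnection Γ)
      fun _ ↦ christoffelBilin Γ where
  contDiffOn := contDiffOn_const
  d_cov x _ Y hY v := by
    rw [translationCoordinates_d, translationCoordinates_d]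
    have h : (translationCoordinates c).pull Y = fun x ↦ Y (x + c) :=
      funext (translationCoordinates_pull c Y)
    rw [h]
    change fderiv ℝ (fun x ↦ Y (x + c)) x v + _ = _
    rw [fderiv_comp_add_right]
    rfl

/-- Translations preserve a connection with constant symbols, and they act transitively. -/
theorem isHomogeneous_christoffelConnection (Γ : Fin 2 → Fin 2 → Fin 2 → ℝ) :
    IsHomogeneous (christoffelConnection Γ) := fun p q ↦
  ⟨translation (q - p), (represents_translationCoordinates Γ (q - p)).isLocalAffineIso,
    add_sub_cancel p q⟩

theorem ricci_model (u v : ℝ) (x s t : Plane) : ricci (model u v) x s t = v * (s 1 * t 1) := by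
  have hs (w : Plane) : IsSmoothFieldAt
      (extend Plane (show TangentSpace (𝓡 2) x from w) : Π y : Plane, TangentSpace (𝓡 2) y) x :=
    contMDiffAt_extend (𝓡 2) Plane _
  have hd (w : Plane) : (translationCoordinates 0).d x
      ((extend Plane (show TangentSpace (𝓡 2) x from w) : Π y : Plane, TangentSpace (𝓡 2) y) x) =
      w :=
    (translationCoordinates_d 0 x _).trans (extend_apply_self _ _)
  -- The fields `extend` are only known to be smooth near x, which suffices for `d_curvature`;
  -- translation by 0 serves as the identity chart.
  have h (k : Fin 2) : (show Plane from curvature (model u v)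
      (extend Plane (show TangentSpace (𝓡 2) x from EuclideanSpace.single k (1 : ℝ)))
        (extend Plane (show TangentSpace (𝓡 2) x from s))
        (extend Plane (show TangentSpace (𝓡 2) x from t)) x) = _ :=
    (translationCoordinates_d 0 x _).symm.trans
      ((represents_translationCoordinates (modelSymbols u v) 0).d_curvature
        (mem_univ x) (hs (EuclideanSpace.single k 1)) (hs s) (hs t))
  simp only [hd, planeCurvature_model] at h
  have e : ricci (model u v) x s t = ∑ k : Fin 2, _ :=
    Finset.sum_congr rfl fun k _ ↦ congrArg (fun w : Plane ↦ w k) (h k)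
  rw [e, Fin.sum_univ_two]
  simp
  ring

variable {M : Type*} [TopologicalSpace M] [ChartedSpace Plane M] [IsManifold (𝓡 2) ∞ M]

/-- The parameters of a model to which a surface is isomorphic near a point are unique. -/
theorem Represents.parameters_unique {φ φ' : Coordinates M} {cov : Connection M} {p q : ℝ × ℝ}
    (hp : p ∈ modelParameters) (hq : q ∈ modelParameters)
    (h : Represents φ cov fun _ ↦ christoffelBilin (modelSymbols p.1 p.2))
    (h' : Represents φ' cov fun _ ↦ christoffelBilin (modelSymbols q.1 q.2)) {x : M}
    (hx : x ∈ φ.source) (hx' : x ∈ φ'.source) : p = q := by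
  set X : Π x : M, TangentSpace (𝓡 2) x := φ'.pull fun _ ↦ EuclideanSpace.single 0 1 with hX
  set Y : Π x : M, TangentSpace (𝓡 2) x := φ'.pull fun _ ↦ EuclideanSpace.single 1 1 with hY
  have hXs : IsSmoothFieldAt X x := φ'.contMDiffAt_pull hx' contDiffAt_const
  have hYs : IsSmoothFieldAt Y x := φ'.contMDiffAt_pull hx' contDiffAt_const
  have hdX : φ'.d x (X x) = EuclideanSpace.single 0 1 := φ'.d_pull hx' _
  have hdY : φ'.d x (Y x) = EuclideanSpace.single 1 1 := φ'.d_pull hx' _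
  -- Both invariants are computed in φ' first; evaluating the same vectors through φ then compares
  -- the two sets of parameters.
  have hT : torsion cov X Y x = q.1 • X x := by
    refine φ'.d_injective hx' ?_
    rw [h'.d_torsion hx' hXs hYs, planeTorsion_model, map_smul, hdX, hdY]
    ext k; fin_cases k <;> simp
  have hR : curvature cov X Y Y x = q.2 • X x := by
    refine φ'.d_injective hx' ?_
    rw [h'.d_curvature hx' hXs hYs hYs, planeCurvature_model, map_smul, hdX, hdY]
    ext k; fin_cases k <;> simp
  have hX0 : φ.d x (X x) ≠ 0 := by
    intro h0
    have h1 := φ.d_injective hx (h0.trans (map_zero _).symm)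
    rw [h1, map_zero] at hdX
    simpa using congrArg (fun w : Plane ↦ w 0) hdX
  have eT := h.d_torsion hx hXs hYs
  have eR := h.d_curvature hx hXs hYs hYs
  rw [hT, map_smul, planeTorsion_model] at eT
  rw [hR, map_smul, planeCurvature_model] at eR
  generalize φ.d x (X x) = a at *
  generalize φ.d x (Y x) = b at *
  have t0 : q.1 * a 0 = p.1 * (a 0 * b 1 - a 1 * b 0) := by
    simpa using congrArg (fun w : Plane ↦ w 0) eT
  have t1 : q.1 = 0 ∨ a 1 = 0 := by simpa using congrArg (fun w : Plane ↦ w 1) eT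
  have r0 : q.2 * a 0 = p.2 * b 1 * (a 0 * b 1 - a 1 * b 0) := by
    simpa using congrArg (fun w : Plane ↦ w 0) eR
  have hpos {r : ℝ × ℝ} (hr : r ∈ modelParameters) : 0 < r.1 := by
    rcases hr with rfl | hr
    · exact one_pos
    · exact hr.1
  -- Torsion of a model takes values in the line of ∂₁, so the change of coordinates preserves this
  -- line.
  have ha1 : a 1 = 0 := t1.resolve_left (hpos hq).ne'
  have ha0 : a 0 ≠ 0 := fun h0 ↦ hX0 (by ext k; fin_cases k <;> simp [h0, ha1])
  have e1 : q.1 = p.1 * b 1 := mul_right_cancel₀ ha0 (by rw [t0, ha1]; ring)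
  have e2 : q.2 = p.2 * b 1 ^ 2 := mul_right_cancel₀ ha0 (by rw [r0, ha1]; ring)
  -- Positivity of both u's excludes b = −1, so the second parameters determine the scaling unless
  -- they vanish; in that case both pairs are (1, 0).
  have hb : 0 < b 1 := (pos_iff_pos_of_mul_pos (e1 ▸ hpos hq)).1 (hpos hp)
  have hb2 : 0 < b 1 ^ 2 := by positivity
  have of_eq (h2 : q.2 = p.2) (h0 : p.2 ≠ 0) : p = q := by
    have hb1 : b 1 ^ 2 = 1 := mul_left_cancel₀ h0 (by rw [← e2, h2, mul_one])
    have hb1' : b 1 = 1 := (pow_eq_one_iff_of_nonneg hb.le two_ne_zero).1 hb1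
    exact Prod.ext (by rw [e1, hb1', mul_one]) h2.symm
  rcases hp with rfl | ⟨-, hp⟩ <;> rcases hq with rfl | ⟨-, hq⟩
  · rfl
  · rcases hq with hq | hq <;> simp [hq] at e2
  · have e2' : 0 = p.2 * b 1 ^ 2 := e2
    rcases hp with hp | hp <;> rw [hp] at e2' <;> linarith
  · rcases hp with hp | hp <;> rcases hq with hq | hq
    · exact of_eq (hq.trans hp.symm) (by simp [hp])
    · rw [hp, hq] at e2; linarith
    · rw [hp, hq] at e2; linarith
    · exact of_eq (hq.trans hp.symm) (by simp [hp])

/-- A local isomorphism and the identity chart are two systems of model coordinates around the same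
point, which `parameters_unique` forbids for p ≠ q. -/
theorem not_areSomewhereLocallyEquivalent {p q : ℝ × ℝ} (hp : p ∈ modelParameters)
    (hq : q ∈ modelParameters) (hpq : p ≠ q) :
    ¬ AreSomewhereLocallyEquivalent (model p.1 p.2) (model q.1 q.2) := by
  rintro ⟨φ, ⟨x, hx⟩, hφ⟩
  exact hpq <| (represents_translationCoordinates _ 0).parameters_unique hp hq
    (hφ.represents (isSmoothConnection_christoffelConnection _)) (mem_univ x) hx

theorem AreEquivalent.areSomewhereLocallyEquivalent {N : Type*} [TopologicalSpace N]
    [ChartedSpace Plane N] [IsManifold (𝓡 2) ∞ N] [Nonempty M] {cov : Connection M}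
    {cov' : Connection N} (h : AreEquivalent cov cov') :
    AreSomewhereLocallyEquivalent cov cov' := by
  obtain ⟨φ, hφ⟩ := h
  exact ⟨φ.toPartialDiffeomorph, univ_nonempty, hφ⟩

end Models

/-! ### Inverse function theorem and the transformation law of Christoffel symbols -/

section ChangeOfCoordinates

theorem Coordinates.d_plane (χ : Coordinates Plane) (z : Plane) : χ.d z = fderiv ℝ χ z :=
  mfderiv_eq_fderiv

theorem Coordinates.contDiffAt (χ : Coordinates Plane) {z : Plane} (hz : z ∈ χ.source) :
    ContDiffAt ℝ ∞ χ z :=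
  contMDiffAt_iff_contDiffAt.1 (χ.contMDiffAt hz)

theorem Coordinates.contDiffAt_pull_const (χ : Coordinates Plane) {z : Plane}
    (hz : z ∈ χ.source) (b : Plane) :
    ContDiffAt ℝ ∞ (χ.pull fun _ ↦ b : Plane → Plane) z :=
  contDiffAt_planeField.1 (χ.contMDiffAt_pull hz contDiffAt_const)

theorem Coordinates.fderiv_injective (χ : Coordinates Plane) {z : Plane} (hz : z ∈ χ.source) :
    Function.Injective (fderiv ℝ χ z) := by
  have h := χ.d_injective hz
  rw [χ.d_plane] at h
  exact h

theorem Coordinates.fderiv_surjective (χ : Coordinates Plane) {z : Plane} (hz : z ∈ χ.source) :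
    Function.Surjective (fderiv ℝ χ z) :=
  LinearMap.injective_iff_surjective.1 (χ.fderiv_injective hz)

/-- The inverse function theorem, for smooth maps of the plane. -/
theorem exists_coordinates_of_fderiv_injective {U : Set Plane} (hU : IsOpen U) {f : Plane → Plane}
    (hf : ContDiffOn ℝ ∞ f U) {z : Plane} (hz : z ∈ U)
    (h : Function.Injective (fderiv ℝ f z)) :
    ∃ χ : Coordinates Plane, z ∈ χ.source ∧ χ.source ⊆ U ∧ ∀ y, χ y = f y := by
  have hfz (y : Plane) (hy : y ∈ U) : ContDiffAt ℝ ∞ f y := hf.contDiffAt (hU.mem_nhds hy)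
  obtain ⟨e, he⟩ : ∃ e : Plane ≃L[ℝ] Plane, (e : Plane →L[ℝ] Plane) = fderiv ℝ f z :=
    ⟨(LinearEquiv.ofInjectiveEndo _ h).toContinuousLinearEquiv, ContinuousLinearMap.ext fun _ ↦ rfl⟩
  have hd : HasFDerivAt f (e : Plane →L[ℝ] Plane) z := by
    rw [he]
    exact ((hfz z hz).differentiableAt (by simp)).hasFDerivAt
  let Φ := (hfz z hz).toOpenPartialHomeomorph f hd (by simp)
  -- Shrinking to the open set where the differential is invertible makes the local inverse smooth
  -- on its whole domain, not just at the image of z.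
  let V : Set Plane := U ∩ fderiv ℝ f ⁻¹' range
    (fun e : Plane ≃L[ℝ] Plane ↦ (e : Plane →L[ℝ] Plane))
  have hV : IsOpen V :=
    (hf.continuousOn_fderiv_of_isOpen hU (by simp)).isOpen_inter_preimage hU
      ContinuousLinearEquiv.isOpen
  have hzV : z ∈ V := ⟨hz, e, he⟩
  let Ψ := Φ.restrOpen V hV
  have hs : Ψ.source ⊆ V := inter_subset_right
  refine ⟨{ Ψ with
    open_source := Ψ.open_source
    open_target := Ψ.open_target
    contMDiffOn_toFun := (hf.mono (hs.trans inter_subset_left)).contMDiffOn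
    contMDiffOn_invFun := ContDiffOn.contMDiffOn fun y hy ↦ ?_ },
    ⟨ContDiffAt.mem_toOpenPartialHomeomorph_source _ hd _, hzV⟩, hs.trans inter_subset_left,
    fun y ↦ rfl⟩
  have hy' := hs (Ψ.map_target hy)
  obtain ⟨e', he'⟩ := hy'.2
  have hd' : HasFDerivAt Ψ (e' : Plane →L[ℝ] Plane) (Ψ.symm y) := by
    have he'' : (e' : Plane →L[ℝ] Plane) = fderiv ℝ f (Ψ.symm y) := he'
    rw [he'']
    exact ((hfz _ hy'.1).differentiableAt (by simp)).hasFDerivAt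
  exact (Ψ.contDiffAt_symm hy hd' (hfz _ hy'.1)).contDiffWithinAt

variable {M : Type*} [TopologicalSpace M] [ChartedSpace Plane M]

theorem Coordinates.d_trans (φ : Coordinates M) (χ : Coordinates Plane) {x : M}
    (hx : x ∈ φ.source) (hx' : φ x ∈ χ.source) (v : TangentSpace (𝓡 2) x) :
    Coordinates.d (φ.trans χ) x v = fderiv ℝ χ (φ x) (φ.d x v) := by
  have h := mfderiv_comp_apply x ((χ.contMDiffAt hx').mdifferentiableAt (by simp))
    ((φ.contMDiffAt hx).mdifferentiableAt (by simp)) v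
  rw [mfderiv_eq_fderiv] at h
  exact h

variable [IsManifold (𝓡 2) ∞ M]

/-- Every point of a surface is in the domain of some coordinates. -/
theorem exists_coordinates (p : M) : ∃ φ : Coordinates M, p ∈ φ.source :=
  ⟨{ chartAt Plane p with
      open_source := (chartAt Plane p).open_source
      open_target := (chartAt Plane p).open_target
      contMDiffOn_toFun := contMDiffOn_chart
      contMDiffOn_invFun := contMDiffOn_chart_symm }, mem_chart_source Plane p⟩

variable {φ : Coordinates M} {cov : Connection M} {G : Plane → Plane →L[ℝ] Plane →L[ℝ] Plane}

/-- The transformation law of the Christoffel symbols. -/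
theorem Represents.trans_apply (h : Represents φ cov G) (χ : Coordinates Plane)
    {G' : Plane → Plane →L[ℝ] Plane →L[ℝ] Plane} (h' : Represents (φ.trans χ) cov G') {z : Plane}
    (hz : z ∈ φ.target) (hz' : z ∈ χ.source) (s t : Plane) :
    G' (χ z) (fderiv ℝ χ z s) (fderiv ℝ χ z t) =
      fderiv ℝ χ z (G z s t) - fderiv ℝ (fun y ↦ fderiv ℝ χ y t) z s := by
  set x := φ.symm z with hxz
  have hx : x ∈ φ.source := φ.mapsTo_symm hz
  have hφx : φ x = z := φ.apply_symm hz
  have hx' : φ x ∈ χ.source := by rwa [hφx]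
  have hxt : x ∈ (φ.trans χ : Coordinates M).source := ⟨hx, hx'⟩
  let A (a : Plane) : Plane → Plane := χ.pull fun _ ↦ a
  have hA (a : Plane) : ContDiffAt ℝ ∞ (A a) z := χ.contDiffAt_pull_const hz' a
  have hχA (a : Plane) {y : Plane} (hy : y ∈ χ.source) : fderiv ℝ χ y (A a y) = a := by
    have := χ.d_pull hy fun _ ↦ a
    rw [χ.d_plane] at this
    exact this
  have hpull (a : Plane) : Coordinates.pull (φ.trans χ) (fun _ ↦ a) =ᶠ[𝓝 x] φ.pull (A a) := by
    filter_upwards [(φ.trans χ : Coordinates M).open_source.mem_nhds hxt] with y hy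
    refine (Coordinates.pull_eq_iff _ hy).2 ?_
    rw [φ.d_trans χ hy.1 hy.2, φ.d_pull hy.1]
    exact (hχA a hy.2).symm
  have key (a b : Plane) : G' (χ z) a b =
      fderiv ℝ χ z (fderiv ℝ (A b) z (A a z) + G z (A a z) (A b z)) := by
    have h1 := h'.d_nabla_pull_const hxt (EventuallyEq.refl _ (Coordinates.pull _ fun _ ↦ a))
      (EventuallyEq.refl _ (Coordinates.pull _ fun _ ↦ b)) contDiffAt_const
    have hAb : DifferentiableAt ℝ (A b) (φ x) := by
      rw [hφx]
      exact (hA b).differentiableAt (by simp)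
    have hs : IsSmoothFieldAt (Coordinates.pull (φ.trans χ) fun _ ↦ b) x :=
      Coordinates.contMDiffAt_pull _ hxt contDiffAt_const
    rw [(nabla_congr cov (hpull a) (hpull b) hs).self_of_nhds,
      h.nabla_pull_apply hx _ hAb, φ.d_trans χ hx hx', φ.d_pull hx, hφx] at h1
    have h2 : (φ.trans χ : Coordinates M) x = χ z := congrArg χ hφx
    rw [h2] at h1
    simpa [planeNabla] using h1.symm
  have hinj := χ.fderiv_injective hz'
  have hAs (s : Plane) : A (fderiv ℝ χ z s) z = s := hinj (hχA _ hz')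
  rw [key, hAs, hAs, map_add]
  set b := fderiv ℝ χ z t
  have hχ' : DifferentiableAt ℝ (fderiv ℝ χ) z :=
    ((χ.contDiffAt hz').fderiv_right (m := 1)
      (one_add_one_eq_two.trans_le two_le_infty)).differentiableAt (by simp)
  have hAd := (hA b).differentiableAt (by simp)
  have hz2 := (hχ'.hasFDerivAt.clm_apply hAd.hasFDerivAt).fderiv
  -- Differentiating dχ(A b) = b expresses the derivative of the field A b by the second derivative
  -- of χ.
  have hconst : (fun y ↦ fderiv ℝ χ y (A b y)) =ᶠ[𝓝 z] fun _ ↦ b := by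
    filter_upwards [χ.open_source.mem_nhds hz'] with y hy using hχA b hy
  rw [hconst.fderiv_eq] at hz2
  have hz3 := congrArg (fun L ↦ L s) hz2
  have ht := (hχ'.hasFDerivAt.clm_apply (hasFDerivAt_const t z)).fderiv
  rw [ht]
  simp [hAs, b] at hz3 ⊢
  rw [eq_neg_of_add_eq_zero_left hz3.symm]
  abel

/-- A criterion for given Christoffel symbols to represent a connection after a change of
coordinates. -/
theorem Represents.trans [T2Space M] (hcov : IsSmoothConnection cov) (h : Represents φ cov G)
    (χ : Coordinates Plane) {G' : Plane → Plane →L[ℝ] Plane →L[ℝ] Plane}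
    (hG' : ∀ z ∈ φ.target, z ∈ χ.source → ∀ s t,
      G' (χ z) (fderiv ℝ χ z s) (fderiv ℝ χ z t) =
        fderiv ℝ χ z (G z s t) - fderiv ℝ (fun y ↦ fderiv ℝ χ y t) z s) :
    Represents (φ.trans χ) cov G' := by
  have hc := represents_christoffel (φ.trans χ) hcov
  refine hc.congr fun y hy ↦ ContinuousLinearMap.ext fun a ↦ ContinuousLinearMap.ext fun b ↦ ?_
  have hz : χ.symm y ∈ χ.source := χ.mapsTo_symm hy.1
  have hz' : χ.symm y ∈ φ.target := hy.2
  obtain ⟨s, rfl⟩ := χ.fderiv_surjective hz a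
  obtain ⟨t, rfl⟩ := χ.fderiv_surjective hz b
  have e := (hG' _ hz' hz s t).trans (h.trans_apply χ hc hz' hz s t).symm
  rwa [χ.apply_symm hy.1] at e

/-- The inhomogeneous term of the transformation law is the second derivative of χ; being symmetric,
it drops out of the torsion. -/
theorem planeTorsion_trans [T2Space M] (h : Represents φ cov G) (χ : Coordinates Plane)
    {G' : Plane → Plane →L[ℝ] Plane →L[ℝ] Plane} (h' : Represents (φ.trans χ) cov G') {z : Plane}
    (hz : z ∈ φ.target) (hz' : z ∈ χ.source) (s t : Plane) :
    planeTorsion G' (χ z) (fderiv ℝ χ z s) (fderiv ℝ χ z t) =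
      fderiv ℝ χ z (planeTorsion G z s t) := by
  have hχ' : DifferentiableAt ℝ (fderiv ℝ χ) z :=
    ((χ.contDiffAt hz').fderiv_right (m := 1)
      (one_add_one_eq_two.trans_le two_le_infty)).differentiableAt (by simp)
  have hd (s t : Plane) : fderiv ℝ (fun y ↦ fderiv ℝ χ y t) z s =
      fderiv ℝ (fderiv ℝ χ) z s t := by
    rw [(hχ'.hasFDerivAt.clm_apply (hasFDerivAt_const t z)).fderiv]
    simp
  have hsymm : fderiv ℝ (fderiv ℝ χ) z s t = fderiv ℝ (fderiv ℝ χ) z t s :=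
    ((χ.contDiffAt hz').of_le two_le_infty).isSymmSndFDerivAt (by simp) _ _
  rw [planeTorsion, planeTorsion, h.trans_apply χ h' hz hz', h.trans_apply χ h' hz hz', hd, hd,
    hsymm, map_smul, map_sub]
  congr 1
  abel

end ChangeOfCoordinates

/-! ### Parallel torsion and coordinates with T(∂₁, ∂₂) = ∂₁ -/

section Torsion

variable {M : Type*} [TopologicalSpace M] [ChartedSpace Plane M] [IsManifold (𝓡 2) ∞ M]
  {φ : Coordinates M} {cov : Connection M} {G : Plane → Plane →L[ℝ] Plane →L[ℝ] Plane}

/-- The vector `T(∂₁, ∂₂)`. -/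
def torsionVector (G : Plane → Plane →L[ℝ] Plane →L[ℝ] Plane) (z : Plane) : Plane :=
  planeTorsion G z (EuclideanSpace.single 0 1) (EuclideanSpace.single 1 1)

theorem plane_eq (a : Plane) :
    a = a 0 • EuclideanSpace.single 0 1 + a 1 • EuclideanSpace.single 1 1 := by
  ext i; fin_cases i <;> simp

theorem planeTorsion_eq_smul_torsionVector (G : Plane → Plane →L[ℝ] Plane →L[ℝ] Plane)
    (z a b : Plane) : planeTorsion G z a b = (a 0 * b 1 - a 1 * b 0) • torsionVector G z := by
  rw [torsionVector, planeTorsion, planeTorsion]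
  conv_lhs => rw [plane_eq a, plane_eq b]
  simp only [map_add, map_smul, add_apply, smul_apply]
  module

theorem Represents.torsionVector_contDiffAt (h : Represents φ cov G) {z : Plane}
    (hz : z ∈ φ.target) : ContDiffAt ℝ ∞ (torsionVector G) z :=
  planeTorsion_contDiffAt (h.contDiffAt hz) contDiffAt_const contDiffAt_const

/-- By antisymmetry T(La,b) + T(a,Lb) = tr(L) T(a,b) in dimension two. The outcome is a homogeneous
linear equation for the torsion vector. -/
theorem Represents.fderiv_torsionVector [T2Space M] (h : Represents φ cov G)
    (hT : HasParallelTorsion cov) {z : Plane} (hz : z ∈ φ.target) (w : Plane) :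
    fderiv ℝ (torsionVector G) z w =
      (G z w (EuclideanSpace.single 0 1) 0 + G z w (EuclideanSpace.single 1 1) 1) •
        torsionVector G z - G z w (torsionVector G z) := by
  have e := h.planeTorsion_parallel hT hz w (EuclideanSpace.single 0 1) (EuclideanSpace.single 1 1)
  change fderiv ℝ (torsionVector G) z w + G z w (torsionVector G z) = _ at e
  rw [eq_sub_iff_add_eq, e, planeTorsion_eq_smul_torsionVector, planeTorsion_eq_smul_torsionVector,
    ← add_smul]
  simp

/-- The torsion vanishes near each of its zeros, being parallel. -/
theorem Represents.torsionVector_eq_zero [T2Space M] (h : Represents φ cov G)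
    (hT : HasParallelTorsion cov) {z y : Plane} {B : Set Plane} (hB : Convex ℝ B)
    (hBφ : B ⊆ φ.target) (hz : z ∈ B) (hy : y ∈ B) (h0 : torsionVector G z = 0) :
    torsionVector G y = 0 := by
  let γ : ℝ → Plane := fun t ↦ z + t • (y - z)
  have hγ (t : ℝ) (ht : t ∈ Icc (0 : ℝ) 1) : γ t ∈ φ.target := hBφ (hB.add_smul_sub_mem hz hy ht)
  have hγd (t : ℝ) : HasDerivAt γ (y - z) t := by
    have e := ((hasDerivAt_id t).smul_const (y - z)).const_add z
    rw [one_smul] at e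
    exact e
  have hγc : Continuous γ := by fun_prop
  have hGc : ContinuousOn (fun t ↦ G (γ t) (y - z)) (Icc 0 1) := fun t ht ↦
    (((h.contDiffAt (hγ t ht)).continuousAt.comp hγc.continuousAt).clm_apply
      continuousAt_const).continuousWithinAt
  have hGc' (i : Fin 2) : ContinuousOn
      (fun t ↦ G (γ t) (y - z) (EuclideanSpace.single i 1) i) (Icc 0 1) :=
    (EuclideanSpace.proj i : Plane →L[ℝ] ℝ).continuous.comp_continuousOn
      (hGc.clm_apply continuousOn_const)
  obtain ⟨K, hK⟩ := isCompact_Icc.exists_bound_of_continuousOn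
    (((hGc' 0).add (hGc' 1)).norm.add hGc.norm)
  have hd (t : ℝ) (ht : t ∈ Icc (0 : ℝ) 1) :=
    ((h.torsionVector_contDiffAt (hγ t ht)).differentiableAt
      (by simp)).hasFDerivAt.comp_hasDerivAt t (hγd t)
  -- Grönwall's inequality along the segment from z to y, with K bounding the coefficients of the
  -- linear equation.
  have e := eq_zero_of_abs_deriv_le_mul_abs_self_of_eq_zero_right (K := K)
    (f := fun t ↦ torsionVector G (γ t)) (a := 0) (b := 1)
    (fun t ht ↦ (hd t ht).continuousAt.continuousWithinAt)
    (fun t ht ↦ (hd t (Ico_subset_Icc_self ht)).hasDerivWithinAt) (by simpa [γ] using h0)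
    (fun t ht ↦ ?_) 1 (by simp)
  · simpa [γ] using e
  · have ht' := Ico_subset_Icc_self ht
    rw [h.fderiv_torsionVector hT (hγ t ht')]
    refine (norm_sub_le _ _).trans ?_
    rw [norm_smul]
    have h1 := (G (γ t) (y - z)).le_opNorm (torsionVector G (γ t))
    have h2 := (le_abs_self _).trans (hK t ht')
    simp only [Pi.add_apply] at h2
    calc _ ≤ _ := add_le_add_right h1 _
      _ = _ := (add_mul _ _ _).symm
      _ ≤ _ := mul_le_mul_of_nonneg_right h2 (norm_nonneg _)

/-- The `1`-form `τ` with `T(a, b) = τ(b) a - τ(a) b`. -/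
def torsionForm (G : Plane → Plane →L[ℝ] Plane →L[ℝ] Plane) (z : Plane) : Plane →L[ℝ] ℝ :=
  torsionVector G z 0 • EuclideanSpace.proj 1 - torsionVector G z 1 • EuclideanSpace.proj 0

theorem torsionForm_apply (G : Plane → Plane →L[ℝ] Plane →L[ℝ] Plane) (z a : Plane) :
    torsionForm G z a = torsionVector G z 0 * a 1 - torsionVector G z 1 * a 0 := by
  simp [torsionForm]

theorem planeTorsion_eq_torsionForm (G : Plane → Plane →L[ℝ] Plane →L[ℝ] Plane) (z a b : Plane) :
    planeTorsion G z a b = torsionForm G z b • a - torsionForm G z a • b := by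
  rw [planeTorsion_eq_smul_torsionVector, torsionForm_apply, torsionForm_apply]
  ext i
  fin_cases i <;> simp <;> ring

theorem Represents.torsionForm_contDiffAt (h : Represents φ cov G) {z : Plane}
    (hz : z ∈ φ.target) : ContDiffAt ℝ ∞ (torsionForm G) z := by
  have hv (i : Fin 2) : ContDiffAt ℝ ∞ (fun y ↦ torsionVector G y i) z :=
    (EuclideanSpace.proj i : Plane →L[ℝ] ℝ).contDiff.contDiffAt.comp z
      (h.torsionVector_contDiffAt hz)
  exact ((hv 0).smul contDiffAt_const).sub ((hv 1).smul contDiffAt_const)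

/-- For linearly independent a and b both coefficients must vanish. This is how an identity between
expressions τ(b)a − τ(a)b is turned into one between the forms. -/
theorem eq_zero_of_forall_smul_eq_smul {f g : Plane → ℝ}
    (h : ∀ a b : Plane, f b • a = g a • b) (a : Plane) : f a = 0 := by
  have h1 (i j : Fin 2) (c : Plane) : f c * (EuclideanSpace.single i (1 : ℝ) : Plane) j =
      g (EuclideanSpace.single i 1) * c j := by
    simpa using congrArg (fun w : Plane ↦ w j) (h (EuclideanSpace.single i 1) c)
  have h2 : g (EuclideanSpace.single 0 1) = 0 := by
    simpa using (h1 0 1 (EuclideanSpace.single 1 1)).symm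
  simpa [h2] using h1 0 0 a

/-- The form `τ` is parallel. -/
theorem Represents.fderiv_torsionForm [T2Space M] (h : Represents φ cov G)
    (hT : HasParallelTorsion cov) {z : Plane} (hz : z ∈ φ.target) (w a : Plane) :
    fderiv ℝ (torsionForm G) z w a = torsionForm G z (G z w a) := by
  have hτ := (h.torsionForm_contDiffAt hz).differentiableAt (by simp)
  have hd (a b : Plane) : fderiv ℝ (fun y ↦ planeTorsion G y a b) z w =
      fderiv ℝ (torsionForm G) z w b • a - fderiv ℝ (torsionForm G) z w a • b := by
    have hta (a : Plane) := hτ.hasFDerivAt.clm_apply (hasFDerivAt_const a z)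
    have := (((hta b).smul_const a).sub ((hta a).smul_const b)).fderiv
    simp only [planeTorsion_eq_torsionForm]
    refine (congrArg (fun L : Plane →L[ℝ] Plane ↦ L w) this).trans ?_
    simp
  have key := eq_zero_of_forall_smul_eq_smul
    (f := fun b ↦ fderiv ℝ (torsionForm G) z w b - torsionForm G z (G z w b))
    (g := fun b ↦ fderiv ℝ (torsionForm G) z w b - torsionForm G z (G z w b)) (fun a b ↦ ?_) a
  · exact sub_eq_zero.1 key
  · have e := h.planeTorsion_parallel hT hz w a b
    rw [hd] at e
    simp only [planeTorsion_eq_torsionForm, map_sub, map_smul] at e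
    rw [← sub_eq_zero] at e ⊢
    rw [← e]
    module

/-- Closedness of τ: for a parallel form the antisymmetric part of its derivative is τ(2T(w,a)), and
τ(τ(a)w − τ(w)a) = 0. -/
theorem Represents.fderiv_torsionForm_symm [T2Space M] (h : Represents φ cov G)
    (hT : HasParallelTorsion cov) {z : Plane} (hz : z ∈ φ.target) (w a : Plane) :
    fderiv ℝ (torsionForm G) z w a = fderiv ℝ (torsionForm G) z a w := by
  rw [h.fderiv_torsionForm hT hz, h.fderiv_torsionForm hT hz, ← sub_eq_zero, ← map_sub]
  have e : G z w a - G z a w = (2 : ℝ) • planeTorsion G z w a := by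
    rw [planeTorsion, smul_smul]; norm_num
  rw [e, planeTorsion_eq_torsionForm]
  simp
  ring

/-- The Christoffel symbols `G` have torsion `T(∂₁, ∂₂) = ∂₁`, on the set `U`. -/
def IsNormalizedOn (G : Plane → Plane →L[ℝ] Plane →L[ℝ] Plane) (U : Set Plane) : Prop :=
  ∀ z ∈ U, ∀ a b : Plane, planeTorsion G z a b = b 1 • a - a 1 • b

/-- In normalized coordinates τ is the constant form dz₂, so its being parallel says dz₂(G(w,a)) =
0. -/
theorem Represents.apply_one_eq_zero [T2Space M] (h : Represents φ cov G)
    (hT : HasParallelTorsion cov) (hn : IsNormalizedOn G φ.target) {z : Plane} (hz : z ∈ φ.target)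
    (w a : Plane) : G z w a 1 = 0 := by
  refine eq_zero_of_forall_smul_eq_smul (f := fun a ↦ G z w a 1) (g := fun a ↦ G z w a 1)
    (fun a b ↦ ?_) a
  have hc : (fun y ↦ planeTorsion G y a b) =ᶠ[𝓝 z] fun _ ↦ b 1 • a - a 1 • b := by
    filter_upwards [φ.open_target.mem_nhds hz] with y hy using hn y hy a b
  have e := h.planeTorsion_parallel hT hz w a b
  rw [hc.fderiv_eq, hn z hz, hn z hz, hn z hz, map_sub, map_smul, map_smul] at e
  simp only [fderiv_fun_const, Pi.zero_apply, zero_apply, zero_add] at e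
  rw [← sub_eq_zero] at e ⊢
  rw [← neg_eq_zero, ← e]
  module

/-- Near a point where the parallel torsion does not vanish there are coordinates in which
`T(∂₁, ∂₂) = ∂₁`. -/
theorem Represents.exists_isNormalizedOn [T2Space M] (hcov : IsSmoothConnection cov)
    (hT : HasParallelTorsion cov) (h : Represents φ cov G) {p : M} (hp : p ∈ φ.source)
    (h0 : torsionVector G (φ p) ≠ 0) :
    ∃ (φ' : Coordinates M) (G' : Plane → Plane →L[ℝ] Plane →L[ℝ] Plane),
      p ∈ φ'.source ∧ Represents φ' cov G' ∧ IsNormalizedOn G' φ'.target := by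
  obtain ⟨r, hr, hrφ⟩ := Metric.isOpen_iff.1 φ.open_target _ (φ.mapsTo hp)
  set B := Metric.ball (φ p) r with hB
  have hτ : ContDiffOn ℝ ∞ (torsionForm G) B := fun y hy ↦
    (h.torsionForm_contDiffAt (hrφ hy)).contDiffWithinAt
  -- Poincaré lemma for τ on a ball; F becomes the second coordinate.
  obtain ⟨F, hF⟩ := (convex_ball (φ p) r).exists_forall_hasFDerivAt_of_fderiv_symmetric
    Metric.isOpen_ball (hτ.differentiableOn (by simp))
    fun y hy ↦ h.fderiv_torsionForm_symm hT (hrφ hy)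
  have hFs : ContDiffOn ℝ ∞ F B := by
    rw [contDiffOn_infty_iff_fderiv_of_isOpen Metric.isOpen_ball]
    exact ⟨fun y hy ↦ (hF y hy).differentiableAt.differentiableWithinAt,
      hτ.congr fun y hy ↦ (hF y hy).fderiv⟩
  -- With (v₁,v₂) the torsion vector at the point, τ has coefficients (−v₂,v₁) and l has (v₁,v₂);
  -- their determinant is v₁² + v₂² ≠ 0. Any l independent of τ there would do.
  let l : Plane →L[ℝ] ℝ := torsionVector G (φ p) 0 • EuclideanSpace.proj 0 +
    torsionVector G (φ p) 1 • EuclideanSpace.proj 1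
  let f : Plane → Plane := fun y ↦
    l y • EuclideanSpace.single 0 1 + F y • EuclideanSpace.single 1 1
  have hf : ContDiffOn ℝ ∞ f B :=
    (l.contDiff.contDiffOn.smul contDiffOn_const).add (hFs.smul contDiffOn_const)
  have hfd (y : Plane) (hy : y ∈ B) (s : Plane) : fderiv ℝ f y s =
      l s • EuclideanSpace.single 0 1 + torsionForm G y s • EuclideanSpace.single 1 1 := by
    have e := ((l.hasFDerivAt (x := y).smul_const (EuclideanSpace.single 0 (1 : ℝ) : Plane)).add
      ((hF y hy).smul_const (EuclideanSpace.single 1 (1 : ℝ) : Plane))).fderiv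
    refine (congrArg (fun L : Plane →L[ℝ] Plane ↦ L s) e).trans ?_
    simp
  have hpB : φ p ∈ B := Metric.mem_ball_self hr
  obtain ⟨χ, hχ, hχB, hχf⟩ := exists_coordinates_of_fderiv_injective Metric.isOpen_ball hf hpB (by
    rw [injective_iff_map_eq_zero]
    intro s hs
    rw [hfd _ hpB] at hs
    have e0 : l s = 0 := by simpa using congrArg (fun w : Plane ↦ w 0) hs
    have e1 : torsionForm G (φ p) s = 0 := by simpa using congrArg (fun w : Plane ↦ w 1) hs
    rw [torsionForm_apply] at e1
    simp only [l, add_apply, smul_apply, PiLp.proj_apply, smul_eq_mul] at e0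
    generalize torsionVector G (φ p) = v at *
    have hv : v 0 ^ 2 + v 1 ^ 2 ≠ 0 := fun hv ↦ h0 (by
      have h1 := (add_eq_zero_iff_of_nonneg (sq_nonneg _) (sq_nonneg _)).1 hv
      ext i
      fin_cases i
      exacts [pow_eq_zero_iff two_ne_zero |>.1 h1.1, pow_eq_zero_iff two_ne_zero |>.1 h1.2])
    ext i
    fin_cases i
    · exact (mul_eq_zero.1 (show (v 0 ^ 2 + v 1 ^ 2) * s 0 = 0 by
        linear_combination v 0 * e0 - v 1 * e1)).resolve_left hv
    · exact (mul_eq_zero.1 (show (v 0 ^ 2 + v 1 ^ 2) * s 1 = 0 by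
        linear_combination v 1 * e0 + v 0 * e1)).resolve_left hv)
  have h' := represents_christoffel (φ.trans χ) hcov
  refine ⟨φ.trans χ, _, ⟨hp, hχ⟩, h', fun y hy a b ↦ ?_⟩
  have hz : χ.symm y ∈ χ.source := χ.mapsTo_symm hy.1
  have hz' : χ.symm y ∈ φ.target := hy.2
  obtain ⟨s, rfl⟩ := χ.fderiv_surjective hz a
  obtain ⟨t, rfl⟩ := χ.fderiv_surjective hz b
  have e := planeTorsion_trans h χ h' hz' hz s t
  rw [χ.apply_symm hy.1] at e
  have hχ1 (s : Plane) : fderiv ℝ χ (χ.symm y) s 1 = torsionForm G (χ.symm y) s := by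
    have : (χ : Plane → Plane) = f := funext hχf
    rw [this, hfd _ (hχB hz)]
    simp
  rw [e, planeTorsion_eq_torsionForm, map_sub, map_smul, map_smul, hχ1, hχ1]

end Torsion

/-! ### Integrable linear systems dP = Ω + l N P -/

section LinearSystem

variable {E F : Type*} [NormedAddCommGroup E] [NormedSpace ℝ E] [NormedAddCommGroup F]
  [NormedSpace ℝ F] [CompleteSpace F] {U : Set E} {Ω : E → E →L[ℝ] F} {l : E →L[ℝ] ℝ}
  {N : F →L[ℝ] F}

theorem hasFDerivAt_exp_smul (l : E →L[ℝ] ℝ) (N : F →L[ℝ] F) (z : E) :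
    HasFDerivAt (fun y ↦ NormedSpace.exp (l y • N))
      (l.smulRight (N * NormedSpace.exp (l z • N))) z :=
  (hasDerivAt_exp_smul_const' N (l z)).hasFDerivAt.comp z l.hasFDerivAt

/-- The solution with given initial value of the linear system `dP = Ω + l N P`, where `N` is a
constant matrix and `l` a constant `1`-form. -/
theorem exists_hasFDerivAt_linear_system (hU : Convex ℝ U) (hUo : IsOpen U)
    (hΩ : DifferentiableOn ℝ Ω U)
    (hdΩ : ∀ z ∈ U, ∀ s t, fderiv ℝ Ω z s t - fderiv ℝ Ω z t s =
      l s • N (Ω z t) - l t • N (Ω z s)) {z₀ : E} (v : F) :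
    ∃ P : E → F, P z₀ = v ∧ ∀ z ∈ U, HasFDerivAt P (Ω z + l.smulRight (N (P z))) z := by
  -- Integrating factor: A P must have differential A Ω, which is closed precisely because of `hdΩ`;
  -- a primitive q then yields P = A⁻¹(q + const), with A⁻¹ = B.
  let A (z : E) : F →L[ℝ] F := NormedSpace.exp ((-l) z • N)
  let B (z : E) : F →L[ℝ] F := NormedSpace.exp (l z • N)
  let _ : NormedAlgebra ℚ (F →L[ℝ] F) := NormedAlgebra.restrictScalars ℚ ℝ _
  have hBA (z : E) (w : F) : B z (A z w) = w := by
    have h : B z * A z = 1 := by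
      have e : (-l) z • N = -(l z • N) := neg_smul _ _
      simp only [A, B]
      rw [e, ← NormedSpace.exp_add_of_commute (Commute.neg_right (Commute.refl _)), add_neg_cancel,
        NormedSpace.exp_zero]
    exact congrArg (fun L : F →L[ℝ] F ↦ L w) h
  have hAN (z : E) (w : F) : N (A z w) = A z (N w) := by
    have h : Commute N (A z) := ((Commute.refl N).smul_right _).exp_right
    exact congrArg (fun L : F →L[ℝ] F ↦ L w) h.eq
  have hA (z : E) := hasFDerivAt_exp_smul (-l) N z
  have hω (z : E) (hz : z ∈ U) :=
    (hA z).clm_comp (hΩ.differentiableAt (hUo.mem_nhds hz)).hasFDerivAt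
  obtain ⟨q, hq⟩ := hU.exists_forall_hasFDerivAt_of_fderiv_symmetric hUo
    (show DifferentiableOn ℝ (fun z ↦ (A z).comp (Ω z)) U from
      fun z hz ↦ (hω z hz).differentiableAt.differentiableWithinAt) (fun z hz s t ↦ by
      have e := congrArg (A z) (hdΩ z hz s t)
      rw [map_sub, map_sub, map_smul, map_smul, ← hAN, ← hAN] at e
      rw [(hω z hz).fderiv, ← sub_eq_zero]
      rw [← sub_eq_zero] at e
      simp only [add_apply, ContinuousLinearMap.comp_apply, ContinuousLinearMap.compL_apply,
        ContinuousLinearMap.flip_apply, ContinuousLinearMap.smulRight_apply, neg_apply,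
        smul_apply, mul_apply_eq_comp]
      rw [← e]
      simp only [A]
      module)
  refine ⟨fun z ↦ B z (q z + (A z₀ v - q z₀)), by simp [hBA], fun z hz ↦ ?_⟩
  have h := (hasFDerivAt_exp_smul l N z).clm_apply ((hq z hz).add_const (A z₀ v - q z₀))
  refine h.congr_fderiv (ContinuousLinearMap.ext fun s ↦ ?_)
  simp only [add_apply, ContinuousLinearMap.comp_apply, ContinuousLinearMap.flip_apply,
    ContinuousLinearMap.smulRight_apply, smul_apply, mul_apply_eq_comp]
  exact congrArg₂ (· + ·) (hBA z _) rfl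

omit [CompleteSpace F] in
-- Bootstrapping: the equation makes the derivative of P as regular as P itself.
theorem contDiffOn_of_hasFDerivAt_linear_system (hUo : IsOpen U) (hΩ : ContDiffOn ℝ ∞ Ω U)
    {P : E → F} (hP : ∀ z ∈ U, HasFDerivAt P (Ω z + l.smulRight (N (P z))) z) :
    ContDiffOn ℝ ∞ P U := by
  have hd : DifferentiableOn ℝ P U := fun z hz ↦ (hP z hz).differentiableAt.differentiableWithinAt
  refine contDiffOn_infty.2 fun n ↦ ?_
  induction n with
  | zero => exact contDiffOn_zero.2 hd.continuousOn
  | succ n ih =>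
    refine (contDiffOn_succ_iff_fderiv_of_isOpen (n := (n : ℕ)) hUo).2
      ⟨hd, fun h ↦ absurd h (by simp), ?_⟩
    refine ContDiffOn.congr (f := fun z ↦ Ω z + l.smulRight (N (P z))) ?_
      fun z hz ↦ (hP z hz).fderiv
    refine (hΩ.of_le (by exact_mod_cast le_top)).add ?_
    exact (ContinuousLinearMap.smulRightL ℝ E F l).contDiff.comp_contDiffOn
      (N.contDiff.comp_contDiffOn ih)

end LinearSystem

/-! ### Consequences of parallel curvature in normalized coordinates -/

section NormalForm

/-- On the convex open set `U` the Christoffel symbols `G` have torsion `T(∂₁, ∂₂) = ∂₁`, and both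
torsion and curvature are parallel. -/
structure IsNormalFormOn (G : Plane → Plane →L[ℝ] Plane →L[ℝ] Plane) (U : Set Plane) : Prop where
  isOpen : IsOpen U
  convex : Convex ℝ U
  contDiffOn : ContDiffOn ℝ ∞ G U
  isNormalizedOn : IsNormalizedOn G U
  apply_one : ∀ z ∈ U, ∀ w a, G z w a 1 = 0
  planeCurvature_parallel : ∀ z ∈ U, ∀ w a b c,
    fderiv ℝ (fun y ↦ planeCurvature G y a b c) z w + G z w (planeCurvature G z a b c) =
      planeCurvature G z (G z w a) b c + planeCurvature G z a (G z w b) c +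
        planeCurvature G z a b (G z w c)

/-- The `1`-form `w ↦ G(w, ∂ᵢ)₁`. -/
def connectionForm (G : Plane → Plane →L[ℝ] Plane →L[ℝ] Plane) (i : Fin 2) (z : Plane) :
    Plane →L[ℝ] ℝ :=
  (EuclideanSpace.proj 0 : Plane →L[ℝ] ℝ) ∘L (G z).flip (EuclideanSpace.single i 1)

/-- The coefficient of `∂₁` in `R(∂₁, ∂₂)∂ᵢ`. -/
def curvatureCoeff (G : Plane → Plane →L[ℝ] Plane →L[ℝ] Plane) (i : Fin 2) (z : Plane) : ℝ :=
  fderiv ℝ (connectionForm G i) z (EuclideanSpace.single 0 1) (EuclideanSpace.single 1 1) -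
    fderiv ℝ (connectionForm G i) z (EuclideanSpace.single 1 1) (EuclideanSpace.single 0 1) +
    connectionForm G 0 z (EuclideanSpace.single 0 1) *
      connectionForm G i z (EuclideanSpace.single 1 1) -
    connectionForm G 0 z (EuclideanSpace.single 1 1) *
      connectionForm G i z (EuclideanSpace.single 0 1)

theorem clm_eq (L : Plane →L[ℝ] ℝ) (s : Plane) :
    L s = s 0 * L (EuclideanSpace.single 0 1) + s 1 * L (EuclideanSpace.single 1 1) := by
  conv_lhs => rw [plane_eq s]
  simp

/-- Alternating forms on the plane are multiples of the determinant, so closedness need only be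
tested on ∂₁, ∂₂. -/
theorem clm_clm_eq (L : Plane →L[ℝ] Plane →L[ℝ] ℝ) (s t : Plane) :
    L s t - L t s = (s 0 * t 1 - s 1 * t 0) *
      (L (EuclideanSpace.single 0 1) (EuclideanSpace.single 1 1) -
        L (EuclideanSpace.single 1 1) (EuclideanSpace.single 0 1)) := by
  conv_lhs => rw [plane_eq s, plane_eq t]
  simp only [map_add, map_smul, add_apply, smul_apply, smul_eq_mul]
  ring

namespace IsNormalFormOn

variable {G : Plane → Plane →L[ℝ] Plane →L[ℝ] Plane} {U : Set Plane} (h : IsNormalFormOn G U)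
  {z : Plane} (hz : z ∈ U)
include h

theorem contDiffOn_connectionForm (i : Fin 2) : ContDiffOn ℝ ∞ (connectionForm G i) U := by
  refine contDiffOn_clm_apply.2 fun w ↦ ?_
  exact (EuclideanSpace.proj 0 : Plane →L[ℝ] ℝ).contDiff.comp_contDiffOn
    ((h.contDiffOn.clm_apply contDiffOn_const).clm_apply contDiffOn_const)

theorem contDiffOn_curvatureCoeff (i : Fin 2) : ContDiffOn ℝ ∞ (curvatureCoeff G i) U := by
  have hd := (h.contDiffOn_connectionForm i).fderiv_of_isOpen h.isOpen (m := ∞) (by simp)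
  have hc (i j : Fin 2) : ContDiffOn ℝ ∞
      (fun z ↦ connectionForm G i z (EuclideanSpace.single j 1)) U :=
    (h.contDiffOn_connectionForm i).clm_apply contDiffOn_const
  have hdc (j k : Fin 2) : ContDiffOn ℝ ∞ (fun z ↦ fderiv ℝ (connectionForm G i) z
      (EuclideanSpace.single j 1) (EuclideanSpace.single k 1)) U :=
    (hd.clm_apply contDiffOn_const).clm_apply contDiffOn_const
  exact (((hdc 0 1).sub (hdc 1 0)).add ((hc 0 0).mul (hc i 1))).sub ((hc 0 1).mul (hc i 0))

include hz

theorem differentiableAt_connectionForm (i : Fin 2) :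
    DifferentiableAt ℝ (connectionForm G i) z :=
  ((h.contDiffOn_connectionForm i).contDiffAt (h.isOpen.mem_nhds hz)).differentiableAt (by simp)

theorem apply_eq (s t : Plane) : G z s t =
    (connectionForm G 0 z s * t 0 + connectionForm G 1 z s * t 1) • EuclideanSpace.single 0 1 := by
  ext i
  fin_cases i
  · have e : G z s t 0 =
        G z s (t 0 • EuclideanSpace.single 0 1 + t 1 • EuclideanSpace.single 1 1) 0 := by
      rw [← plane_eq]
    change G z s t 0 = _
    rw [e, map_add, map_smul, map_smul]
    simp [connectionForm, mul_comm]
  · simpa using h.apply_one z hz s t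

/-- This is T(∂₁,∂₂) = ∂₁; the 2 undoes the factor ½ in the torsion. -/
theorem connectionForm_one_single_zero : connectionForm G 1 z (EuclideanSpace.single 0 1) =
    connectionForm G 0 z (EuclideanSpace.single 1 1) + 2 := by
  have e := congrArg (fun w : Plane ↦ w 0)
    (h.isNormalizedOn z hz (EuclideanSpace.single 0 1) (EuclideanSpace.single 1 1))
  simp only [planeTorsion, h.apply_eq hz] at e
  simp at e
  linarith

theorem planeCurvature_eq (s t c : Plane) : planeCurvature G z s t c =
    ((s 0 * t 1 - s 1 * t 0) * (curvatureCoeff G 0 z * c 0 + curvatureCoeff G 1 z * c 1)) •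
      EuclideanSpace.single 0 1 := by
  have hG : DifferentiableAt ℝ G z :=
    (h.contDiffOn.contDiffAt (h.isOpen.mem_nhds hz)).differentiableAt (by simp)
  have hd (s t : Plane) : fderiv ℝ G z s t c = (fderiv ℝ (connectionForm G 0) z s t * c 0 +
      fderiv ℝ (connectionForm G 1) z s t * c 1) • EuclideanSpace.single 0 1 := by
    have e1 := ((hG.hasFDerivAt.clm_apply (hasFDerivAt_const t z)).clm_apply
      (hasFDerivAt_const c z)).fderiv
    have e2 : (fun y ↦ G y t c) =ᶠ[𝓝 z] fun y ↦ (connectionForm G 0 y t * c 0 +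
        connectionForm G 1 y t * c 1) • EuclideanSpace.single 0 1 := by
      filter_upwards [h.isOpen.mem_nhds hz] with y hy using h.apply_eq hy t c
    have hr (i : Fin 2) := ((h.differentiableAt_connectionForm hz i).hasFDerivAt.clm_apply
      (hasFDerivAt_const t z)).mul_const (c i)
    have e3 := (((hr 0).add (hr 1)).smul_const (EuclideanSpace.single 0 (1 : ℝ) : Plane)).fderiv
    have e := congrArg (fun L : Plane →L[ℝ] Plane ↦ L s)
      (e1.symm.trans (e2.fderiv_eq.trans e3))
    simpa [mul_comm] using e
  rw [planeCurvature, hd, hd, h.apply_eq hz t c, h.apply_eq hz s c, map_smul, map_smul,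
    h.apply_eq hz s, h.apply_eq hz t]
  have h0 := clm_clm_eq (fderiv ℝ (connectionForm G 0) z) s t
  have h1 := clm_clm_eq (fderiv ℝ (connectionForm G 1) z) s t
  simp only [smul_smul, ← sub_smul, ← add_smul, curvatureCoeff]
  congr 1
  rw [clm_eq (connectionForm G 0 z) s, clm_eq (connectionForm G 0 z) t,
    clm_eq (connectionForm G 1 z) s, clm_eq (connectionForm G 1 z) t]
  simp
  linear_combination c 0 * h0 + c 1 * h1

/-- Evaluate ∇R = 0 on R(∂₁,∂₂)∂ᵢ. All ∇∂ⱼ are multiples of ∂₁, so the term differentiating ∂₂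
vanishes and the one differentiating ∂₁ cancels the derivative of the value. -/
theorem fderiv_curvatureCoeff (i : Fin 2) :
    fderiv ℝ (curvatureCoeff G i) z = curvatureCoeff G 0 z • connectionForm G i z := by
  ext w
  have hd : fderiv ℝ (fun y ↦ planeCurvature G y (EuclideanSpace.single 0 1)
      (EuclideanSpace.single 1 1) (EuclideanSpace.single i 1)) z w =
      fderiv ℝ (curvatureCoeff G i) z w • EuclideanSpace.single 0 1 := by
    have e2 : (fun y ↦ planeCurvature G y (EuclideanSpace.single 0 1)
        (EuclideanSpace.single 1 1) (EuclideanSpace.single i 1)) =ᶠ[𝓝 z]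
        fun y ↦ curvatureCoeff G i y • EuclideanSpace.single 0 1 := by
      filter_upwards [h.isOpen.mem_nhds hz] with y hy
      rw [h.planeCurvature_eq hy]
      fin_cases i <;> simp
    have hc := (((h.contDiffOn_curvatureCoeff i).contDiffAt
      (h.isOpen.mem_nhds hz)).differentiableAt (by simp)).hasFDerivAt
    rw [e2.fderiv_eq, (hc.smul_const (EuclideanSpace.single 0 (1 : ℝ) : Plane)).fderiv]
    simp
  have e := h.planeCurvature_parallel z hz w (EuclideanSpace.single 0 1)
    (EuclideanSpace.single 1 1) (EuclideanSpace.single i 1)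
  rw [hd] at e
  simp only [h.planeCurvature_eq hz, h.apply_eq hz] at e
  have e0 := congrArg (fun w : Plane ↦ w 0) e
  fin_cases i <;> simp at e0 ⊢ <;> linarith

/-- From dc₁ = c₁ω₁, symmetry of the second derivative of c₁ gives c₁ dω₁ = 0. The quadratic terms
of c₁ cancel, so c₁ = dω₁(∂₁,∂₂) and c₁² = 0. -/
theorem curvatureCoeff_zero : curvatureCoeff G 0 z = 0 := by
  have hc := (h.contDiffOn_curvatureCoeff 0).contDiffAt (h.isOpen.mem_nhds hz)
  have hsymm := (hc.of_le two_le_infty).isSymmSndFDerivAt (by simp)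
    (EuclideanSpace.single 0 1) (EuclideanSpace.single 1 1)
  have e : fderiv ℝ (curvatureCoeff G 0) =ᶠ[𝓝 z]
      fun y ↦ curvatureCoeff G 0 y • connectionForm G 0 y := by
    filter_upwards [h.isOpen.mem_nhds hz] with y hy using h.fderiv_curvatureCoeff hy 0
  have e2 : fderiv ℝ (fun y ↦ curvatureCoeff G 0 y • connectionForm G 0 y) z = _ :=
    ((hc.differentiableAt (by simp)).hasFDerivAt.smul
      (h.differentiableAt_connectionForm hz 0).hasFDerivAt).fderiv
  rw [e.fderiv_eq, e2, h.fderiv_curvatureCoeff hz] at hsymm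
  simp at hsymm
  have e' : curvatureCoeff G 0 z * curvatureCoeff G 0 z = 0 := by
    conv_lhs => enter [2]; rw [curvatureCoeff]
    linear_combination hsymm
  exact mul_self_eq_zero.1 e'

/-- Closedness of ω₁, whose exterior derivative is measured by c₁ = 0. -/
theorem fderiv_connectionForm_symm (s t : Plane) :
    fderiv ℝ (connectionForm G 0) z s t = fderiv ℝ (connectionForm G 0) z t s := by
  have h0 := h.curvatureCoeff_zero hz
  rw [curvatureCoeff] at h0
  rw [← sub_eq_zero, clm_clm_eq]
  linear_combination (s 0 * t 1 - s 1 * t 0) * h0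

theorem curvatureCoeff_one_eq {y : Plane} (hy : y ∈ U) :
    curvatureCoeff G 1 y = curvatureCoeff G 1 z :=
  h.isOpen.is_const_of_fderiv_eq_zero h.convex.isPreconnected
    ((h.contDiffOn_curvatureCoeff 1).differentiableOn (by simp))
    (fun w hw ↦ by rw [h.fderiv_curvatureCoeff hw, h.curvatureCoeff_zero hw, zero_smul]; rfl) hy hz

end IsNormalFormOn

end NormalForm

/-! ### Construction of the model coordinates -/

section ModelCoordinates

/-- The linear map `(y, w) ↦ (w, -2w - κy)`. -/
def companionMap (κ : ℝ) : Plane →L[ℝ] Plane :=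
  (EuclideanSpace.proj 1 : Plane →L[ℝ] ℝ).smulRight (EuclideanSpace.single 0 1) +
    ((-2 : ℝ) • EuclideanSpace.proj 1 - κ • EuclideanSpace.proj 0 : Plane →L[ℝ] ℝ).smulRight
      (EuclideanSpace.single 1 1)

theorem companionMap_apply (κ : ℝ) (v : Plane) : companionMap κ v =
    v 1 • EuclideanSpace.single 0 1 + (-2 * v 1 - κ * v 0) • EuclideanSpace.single 1 1 := by
  simp [companionMap]

/-- Every curvature constant is that of one of the models. -/
theorem exists_modelParameters (κ : ℝ) : ∃ p ∈ modelParameters, κ * p.1 ^ 2 = p.2 := by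
  rcases lt_trichotomy κ 0 with hκ | rfl | hκ
  -- Rescaling the second coordinate by 1/u multiplies κ by u², so u = |κ|^(-1/2) brings it to ±1.
  · refine ⟨((√(-κ))⁻¹, -1), Or.inr ⟨by simpa using hκ, Or.inr rfl⟩, ?_⟩
    rw [inv_pow, Real.sq_sqrt (by linarith), inv_neg, mul_neg, mul_inv_cancel₀ hκ.ne]
  · exact ⟨(1, 0), Or.inl rfl, by simp⟩
  · refine ⟨((√κ)⁻¹, 1), Or.inr ⟨by simpa using hκ, Or.inl rfl⟩, ?_⟩
    rw [inv_pow, Real.sq_sqrt hκ.le]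
    field_simp

theorem pos_of_mem_modelParameters {p : ℝ × ℝ} (hp : p ∈ modelParameters) : 0 < p.1 := by
  rcases hp with rfl | hp
  · exact one_pos
  · exact hp.1

namespace IsNormalFormOn

variable {G : Plane → Plane →L[ℝ] Plane →L[ℝ] Plane} {U : Set Plane}

/-- A potential of the connection form of `∂₁`. -/
theorem exists_potential (h : IsNormalFormOn G U) :
    ∃ ψ : Plane → ℝ, ∀ z ∈ U, HasFDerivAt ψ (connectionForm G 0 z) z :=
  h.convex.exists_forall_hasFDerivAt_of_fderiv_symmetric h.isOpen
    ((h.contDiffOn_connectionForm 0).differentiableOn (by simp))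
    fun _ hz ↦ h.fderiv_connectionForm_symm hz

/-- The function `P = (y, w)` such that `log y` is a coordinate of the model. -/
theorem exists_solution (h : IsNormalFormOn G U) {z₀ : Plane} (hz₀ : z₀ ∈ U) {ψ : Plane → ℝ}
    (hψ : ∀ z ∈ U, HasFDerivAt ψ (connectionForm G 0 z) z) :
    ∃ P : Plane → Plane, ContDiffOn ℝ ∞ P U ∧ P z₀ 0 = 1 ∧ ∀ z ∈ U,
      (∀ s, fderiv ℝ P z s 0 = Real.exp (ψ z) * s 0 + s 1 * P z 1) ∧
      ∀ s, fderiv ℝ P z s 1 = Real.exp (ψ z) * (connectionForm G 1 z s - 2 * s 0) +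
        s 1 * (-2 * P z 1 - curvatureCoeff G 1 z₀ * P z 0) := by
  -- The inhomogeneity e^ψ θ of the system for (y,w): dy = e^ψ dz₁ + w dz₂ and dw = e^ψ(ω₂ − 2dz₁) +
  -- (−2w − κy)dz₂.
  let θ (z : Plane) : Plane →L[ℝ] Plane :=
    (EuclideanSpace.proj 0 : Plane →L[ℝ] ℝ).smulRight (EuclideanSpace.single 0 1) +
      (connectionForm G 1 z - (2 : ℝ) • EuclideanSpace.proj 0 : Plane →L[ℝ] ℝ).smulRight
        (EuclideanSpace.single 1 1)
  have hθ : ContDiffOn ℝ ∞ θ U :=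
    contDiffOn_const.add (((ContinuousLinearMap.smulRightL ℝ Plane Plane).flip
      (EuclideanSpace.single 1 1)).contDiff.comp_contDiffOn
        ((h.contDiffOn_connectionForm 1).sub contDiffOn_const))
  have hψs : ContDiffOn ℝ ∞ ψ U := by
    rw [contDiffOn_infty_iff_fderiv_of_isOpen h.isOpen]
    exact ⟨fun y hy ↦ (hψ y hy).differentiableAt.differentiableWithinAt,
      (h.contDiffOn_connectionForm 0).congr fun y hy ↦ (hψ y hy).fderiv⟩
  let Ω (z : Plane) : Plane →L[ℝ] Plane := Real.exp (ψ z) • θ z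
  have hΩ : ContDiffOn ℝ ∞ Ω U := hψs.exp.smul hθ
  have hd (z : Plane) (hz : z ∈ U) (s t : Plane) : fderiv ℝ Ω z s t =
      (Real.exp (ψ z) * connectionForm G 0 z s) • θ z t +
        Real.exp (ψ z) • (fderiv ℝ (connectionForm G 1) z s t • EuclideanSpace.single 1 1) := by
    have hθd : fderiv ℝ θ z s t =
        fderiv ℝ (connectionForm G 1) z s t • EuclideanSpace.single 1 1 := by
      have e1 := (((hθ.contDiffAt (h.isOpen.mem_nhds hz)).differentiableAt
        (by simp)).hasFDerivAt.clm_apply (hasFDerivAt_const t z)).fderiv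
      have e2 := ((((h.differentiableAt_connectionForm hz 1).hasFDerivAt.clm_apply
        (hasFDerivAt_const t z)).sub_const (2 * t 0)).smul_const
          (EuclideanSpace.single 1 (1 : ℝ) : Plane)).const_add
            (t 0 • EuclideanSpace.single 0 (1 : ℝ)) |>.fderiv
      have e3 : (fun y ↦ θ y t) = fun y ↦ t 0 • EuclideanSpace.single 0 (1 : ℝ) +
          (connectionForm G 1 y t - 2 * t 0) • EuclideanSpace.single 1 1 := by
        funext y
        simp [θ]
      rw [e3] at e1
      have e := congrArg (fun L : Plane →L[ℝ] Plane ↦ L s) (e1.symm.trans e2)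
      simpa using e
    have e1 : fderiv ℝ Ω z = _ := ((hψ z hz).exp.smul
      ((hθ.contDiffAt (h.isOpen.mem_nhds hz)).differentiableAt (by simp)).hasFDerivAt).fderiv
    rw [e1]
    simp only [add_apply, smul_apply, ContinuousLinearMap.smulRight_apply, hθd, smul_eq_mul]
    abel
  have hθa (z t : Plane) : θ z t = t 0 • EuclideanSpace.single 0 (1 : ℝ) +
      (connectionForm G 1 z t - 2 * t 0) • EuclideanSpace.single 1 1 := by
    simp [θ]
  obtain ⟨P, hP0, hP⟩ := exists_hasFDerivAt_linear_system (l := EuclideanSpace.proj 1)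
    (N := companionMap (curvatureCoeff G 1 z₀)) h.convex h.isOpen (hΩ.differentiableOn (by simp))
    (fun z hz s t ↦ by
      -- Integrability: the first component is the relation ω₂(∂₁) = ω₁(∂₂) + 2, and the second is
      -- the formula for the constant c₂.
      have h1 := clm_clm_eq (fderiv ℝ (connectionForm G 1) z) s t
      have h2 := h.connectionForm_one_single_zero hz
      have h3 := (h.curvatureCoeff_one_eq hz₀ hz).symm
      rw [h3, curvatureCoeff, hd z hz, hd z hz]
      simp only [companionMap_apply, hθa, Ω, smul_apply]
      rw [clm_eq (connectionForm G 0 z) s, clm_eq (connectionForm G 0 z) t,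
        clm_eq (connectionForm G 1 z) s, clm_eq (connectionForm G 1 z) t, h2]
      ext i
      fin_cases i
      · simp
        ring
      · simp
        linear_combination Real.exp (ψ z) * h1) (z₀ := z₀) (EuclideanSpace.single 0 1)
  refine ⟨P, contDiffOn_of_hasFDerivAt_linear_system h.isOpen hΩ hP, by simp [hP0],
    fun z hz ↦ ⟨fun s ↦ ?_, fun s ↦ ?_⟩⟩ <;>
  · rw [(hP z hz).fderiv]
    simp [Ω, hθa, companionMap_apply]

/-- In suitable coordinates a connection in normal form is one of the models. -/
theorem exists_model_coordinates (h : IsNormalFormOn G U) {z₀ : Plane} (hz₀ : z₀ ∈ U) :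
    ∃ p ∈ modelParameters, ∃ χ : Coordinates Plane, z₀ ∈ χ.source ∧
      ∀ z ∈ χ.source, ∀ s t,
        christoffelBilin (modelSymbols p.1 p.2) (fderiv ℝ χ z s) (fderiv ℝ χ z t) =
          fderiv ℝ χ z (G z s t) - fderiv ℝ (fun y ↦ fderiv ℝ χ y t) z s := by
  obtain ⟨⟨u, v⟩, hp, hκ⟩ := exists_modelParameters (curvatureCoeff G 1 z₀)
  have hu : u ≠ 0 := (pos_of_mem_modelParameters hp).ne'
  simp only at hκ
  obtain ⟨ψ, hψ⟩ := h.exists_potential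
  obtain ⟨P, hPs, hP0, hPd⟩ := h.exists_solution hz₀ hψ
  -- The initial value y = 1 at z₀ keeps y positive nearby, so that log y is smooth there.
  let V : Set Plane := U ∩ {z | 0 < P z 0}
  have hP0s : ContDiffOn ℝ ∞ (fun z ↦ P z 0) U :=
    (EuclideanSpace.proj 0 : Plane →L[ℝ] ℝ).contDiff.comp_contDiffOn hPs
  have hV : IsOpen V := hP0s.continuousOn.isOpen_inter_preimage h.isOpen isOpen_Ioi
  have hz₀V : z₀ ∈ V := ⟨hz₀, by simp [hP0]⟩
  have hPi (i : Fin 2) (z : Plane) (hz : z ∈ U) :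
      HasFDerivAt (fun y ↦ P y i) ((EuclideanSpace.proj i : Plane →L[ℝ] ℝ) ∘L fderiv ℝ P z) z :=
    (EuclideanSpace.proj i : Plane →L[ℝ] ℝ).hasFDerivAt.comp z
      ((hPs.contDiffAt (h.isOpen.mem_nhds hz)).differentiableAt (by simp)).hasFDerivAt
  -- Dividing z₂ by u turns the normalized torsion ∂₁ into u∂₁, and κ into κu² = v.
  let f (z : Plane) : Plane := Real.log (P z 0) • EuclideanSpace.single 0 1 +
    (z 1 / u) • EuclideanSpace.single 1 1
  have hl : ContDiffOn ℝ ∞ (fun z : Plane ↦ z 1 / u) V :=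
    ((EuclideanSpace.proj 1 : Plane →L[ℝ] ℝ).contDiff.div_const u).contDiffOn
  have hf : ContDiffOn ℝ ∞ f V :=
    (((hP0s.mono inter_subset_left).log fun z hz ↦ hz.2.ne').smul contDiffOn_const).add
      (hl.smul contDiffOn_const)
  have hfd (z : Plane) (hz : z ∈ V) (t : Plane) : fderiv ℝ f z t =
      ((P z 0)⁻¹ * (Real.exp (ψ z) * t 0 + t 1 * P z 1)) • EuclideanSpace.single 0 1 +
        (t 1 / u) • EuclideanSpace.single 1 1 := by
    have e : fderiv ℝ f z = _ :=
      ((((hPi 0 z hz.1).log hz.2.ne').smul_const (EuclideanSpace.single 0 (1 : ℝ) : Plane)).add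
        (((EuclideanSpace.proj 1 : Plane →L[ℝ] ℝ).hasFDerivAt (x := z).mul_const u⁻¹).smul_const
          (EuclideanSpace.single 1 (1 : ℝ) : Plane))).fderiv
    rw [e, ← (hPd z hz.1).1]
    simp [div_eq_mul_inv, mul_comm]
  obtain ⟨χ, hχ, hχV, hχf⟩ := exists_coordinates_of_fderiv_injective hV hf hz₀V (by
    rw [injective_iff_map_eq_zero]
    intro s hs
    rw [hfd _ hz₀V] at hs
    have e1 : s 1 = 0 := by simpa [hu] using congrArg (fun w : Plane ↦ w 1) hs
    have e0 : s 0 = 0 := by simpa [hP0, e1] using congrArg (fun w : Plane ↦ w 0) hs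
    ext i
    fin_cases i
    exacts [e0, e1])
  refine ⟨(u, v), hp, χ, hχ, fun z hz s t ↦ ?_⟩
  have hzV := hχV hz
  have hχ' : (χ : Plane → Plane) = f := funext hχf
  have hy : P z 0 ≠ 0 := hzV.2.ne'
  have h2 : fderiv ℝ (fun y ↦ fderiv ℝ f y t) z s =
      ((P z 0)⁻¹ * (Real.exp (ψ z) * connectionForm G 0 z s * t 0 + t 1 * fderiv ℝ P z s 1) -
        ((P z 0) ^ 2)⁻¹ * fderiv ℝ P z s 0 * (Real.exp (ψ z) * t 0 + t 1 * P z 1)) •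
          EuclideanSpace.single 0 1 := by
    have e : (fun y ↦ fderiv ℝ f y t) =ᶠ[𝓝 z] fun y ↦
        ((P y 0)⁻¹ * (Real.exp (ψ y) * t 0 + t 1 * P y 1)) • EuclideanSpace.single 0 1 +
        (t 1 / u) • EuclideanSpace.single 1 1 := by
      filter_upwards [hV.mem_nhds hzV] with y hy using hfd y hy t
    have hinv := (hasDerivAt_inv hy).comp_hasFDerivAt z (hPi 0 z hzV.1)
    have e1 := ((hinv.mul (((hψ z hzV.1).exp.mul_const (t 0)).add
      ((hPi 1 z hzV.1).const_mul (t 1)))).smul_const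
        (EuclideanSpace.single 0 (1 : ℝ) : Plane)).add_const
          ((t 1 / u) • EuclideanSpace.single 1 (1 : ℝ)) |>.fderiv
    refine (congrArg (fun L : Plane →L[ℝ] Plane ↦ L s) (e.fderiv_eq.trans e1)).trans ?_
    simp
    ring
  rw [hχ', h2, hfd z hzV, hfd z hzV, hfd z hzV, (hPd z hzV.1).1, (hPd z hzV.1).2,
    h.apply_eq hzV.1]
  ext i
  fin_cases i
  · refine (christoffelBilin_modelSymbols_zero _ _ _ _).trans ?_
    simp
    rw [← hκ]
    field_simp
    ring
  · refine (christoffelBilin_modelSymbols_one _ _ _ _).trans ?_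
    simp

end IsNormalFormOn

end ModelCoordinates

/-! ### From local normal forms to the global classification -/

section Global

variable {M : Type*} [TopologicalSpace M] [T2Space M] [ChartedSpace Plane M]
  [IsManifold (𝓡 2) ∞ M] {φ : Coordinates M} {cov : Connection M}
  {G : Plane → Plane →L[ℝ] Plane →L[ℝ] Plane}

/-- Provides a chart-independent meaning for nonvanishing of the torsion vector, so that charts can
be compared in the connectedness argument. -/
theorem Represents.exists_torsion_ne_zero_iff (h : Represents φ cov G) {x : M}
    (hx : x ∈ φ.source) :
    (∃ X Y : Π x : M, TangentSpace (𝓡 2) x,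
      IsSmoothField X ∧ IsSmoothField Y ∧ torsion cov X Y x ≠ 0) ↔ torsionVector G (φ x) ≠ 0 := by
  constructor
  · rintro ⟨X, Y, hX, hY, hXY⟩ h0
    refine hXY (φ.d_injective hx ?_)
    rw [h.d_torsion hx (hX x) (hY x), planeTorsion_eq_smul_torsionVector, h0, smul_zero, map_zero]
  · intro h0
    obtain ⟨X, hX, hX'⟩ := φ.exists_isSmoothField hx (EuclideanSpace.single 0 1)
    obtain ⟨Y, hY, hY'⟩ := φ.exists_isSmoothField hx (EuclideanSpace.single 1 1)
    refine ⟨X, Y, hX, hY, fun e ↦ h0 ?_⟩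
    have e' := h.d_torsion hx (hX x) (hY x)
    rw [e, map_zero, hX'.self_of_nhds, hY'.self_of_nhds, φ.d_pull hx, φ.d_pull hx] at e'
    exact e'.symm

/-- On a connected surface a non-zero parallel torsion vanishes nowhere. -/
theorem HasNonzeroTorsion.torsionVector_ne_zero [ConnectedSpace M] (h0 : HasNonzeroTorsion cov)
    (hcov : IsSmoothConnection cov) (hT : HasParallelTorsion cov) (h : Represents φ cov G) {x : M}
    (hx : x ∈ φ.source) : torsionVector G (φ x) ≠ 0 := by
  let S (x : M) : Prop := ∃ X Y : Π x : M, TangentSpace (𝓡 2) x,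
    IsSmoothField X ∧ IsSmoothField Y ∧ torsion cov X Y x ≠ 0
  -- Within a coordinate ball a zero of the torsion spreads to every point, so vanishing and
  -- nonvanishing are both open conditions.
  have hS : IsLocallyConstant S := by
    refine (IsLocallyConstant.iff_eventually_eq S).2 fun p ↦ ?_
    obtain ⟨φ, hp⟩ := exists_coordinates p
    have h := represents_christoffel φ hcov
    obtain ⟨r, hr, hrφ⟩ := Metric.isOpen_iff.1 φ.open_target _ (φ.mapsTo hp)
    have hpr := Metric.mem_ball_self (x := φ p) hr
    filter_upwards [φ.eventually_mem_source hp (Metric.ball_mem_nhds _ hr)] with y hy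
    refine propext ?_
    simp only [S]
    rw [h.exists_torsion_ne_zero_iff hp, h.exists_torsion_ne_zero_iff hy.1]
    exact not_congr ⟨h.torsionVector_eq_zero hT (convex_ball _ _) hrφ hy.2 hpr,
      h.torsionVector_eq_zero hT (convex_ball _ _) hrφ hpr hy.2⟩
  obtain ⟨X, Y, hX, hY, hXY⟩ := h0
  obtain ⟨p, hp⟩ := Function.ne_iff.1 hXY
  rw [← h.exists_torsion_ne_zero_iff hx]
  have e : S x = S p := hS.apply_eq_of_preconnectedSpace x p
  exact e.mpr ⟨X, Y, hX, hY, hp⟩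

/-- Near each point where the torsion does not vanish, the surface is isomorphic to a model. -/
theorem Represents.exists_represents_model (hcov : IsSmoothConnection cov)
    (hR : IsSymmetric cov) (hT : HasParallelTorsion cov) (h : Represents φ cov G) {p : M}
    (hp : p ∈ φ.source) (h0 : torsionVector G (φ p) ≠ 0) :
    ∃ q ∈ modelParameters, ∃ φ' : Coordinates M, p ∈ φ'.source ∧
      Represents φ' cov fun _ ↦ christoffelBilin (modelSymbols q.1 q.2) := by
  obtain ⟨φ', G', hp', h', hn⟩ := h.exists_isNormalizedOn hcov hT hp h0
  obtain ⟨r, hr, hrφ⟩ := Metric.isOpen_iff.1 φ'.open_target _ (φ'.mapsTo hp')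
  have hU : IsNormalFormOn G' (Metric.ball (φ' p) r) :=
    { isOpen := Metric.isOpen_ball
      convex := convex_ball _ _
      contDiffOn := h'.contDiffOn.mono hrφ
      isNormalizedOn := fun z hz ↦ hn z (hrφ hz)
      apply_one := fun z hz ↦ h'.apply_one_eq_zero hT hn (hrφ hz)
      planeCurvature_parallel := fun z hz ↦ h'.planeCurvature_parallel hR (hrφ hz) }
  obtain ⟨q, hq, χ, hχ, hχG⟩ := hU.exists_model_coordinates (Metric.mem_ball_self hr)
  exact ⟨q, hq, φ'.trans χ, ⟨hp', hχ⟩, h'.trans hcov χ fun z _ hz' ↦ hχG z hz'⟩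

/-- A connected surface with parallel curvature and non-zero parallel torsion is modeled on one of
the models. -/
theorem exists_isModeledOn [ConnectedSpace M] (hcov : IsSmoothConnection cov)
    (hR : IsSymmetric cov) (h0 : HasNonzeroTorsion cov) (hT : HasParallelTorsion cov) :
    ∃ q ∈ modelParameters, IsModeledOn cov (model q.1 q.2) := by
  have key (p : M) : ∃ q ∈ modelParameters, ∃ φ : Coordinates M, p ∈ φ.source ∧
      Represents φ cov fun _ ↦ christoffelBilin (modelSymbols q.1 q.2) := by
    obtain ⟨φ, hp⟩ := exists_coordinates p
    have h := represents_christoffel φ hcov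
    exact h.exists_represents_model hcov hR hT hp (h0.torsionVector_ne_zero hcov hT h hp)
  choose q hq φ hφ hqφ using key
  -- On the domain of the chart chosen at p, the parameters chosen at a nearby point y describe the
  -- same connection near y, hence agree with those at p.
  have hc : IsLocallyConstant q := by
    refine (IsLocallyConstant.iff_eventually_eq q).2 fun p ↦ ?_
    filter_upwards [(φ p).open_source.mem_nhds (hφ p)] with y hy
    exact (hqφ y).parameters_unique (hq y) (hq p) (hqφ p) (hφ y) hy
  obtain ⟨p₀⟩ : Nonempty M := inferInstance
  refine ⟨q p₀, hq p₀, isHomogeneous_christoffelConnection _, fun p ↦ ⟨φ p, hφ p, ?_⟩⟩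
  have h := hqφ p
  rw [hc.apply_eq_of_preconnectedSpace p p₀] at h
  exact h.isLocalAffineIso

end Global

end AffineSurface

end

open AffineSurface in
theorem theorem2 :
    (∀ (M : Type*) [TopologicalSpace M] [T2Space M] [ConnectedSpace M]
        [ChartedSpace Plane M] [IsManifold (𝓡 2) ∞ M] (cov : Connection M),
        IsSmoothConnection cov → IsSymmetric cov → HasNonzeroTorsion cov →
        HasParallelTorsion cov →
          IsModeledOn cov (model 1 0) ∨
            ∃ u : ℝ, 0 < u ∧ (IsModeledOn cov (model u 1) ∨ IsModeledOn cov (model u (-1)))) ∧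
    (∀ x (v w : Plane), ricci (model 1 0) x v w = 0) ∧
    (∀ u : ℝ, 0 < u → ∀ x (v w : Plane),
        ricci (model u 1) x v w = v 1 * w 1 ∧ ricci (model u (-1)) x v w = -(v 1 * w 1)) ∧
    (∀ p ∈ modelParameters, IsHomogeneous (model p.1 p.2)) ∧
    (∀ p ∈ modelParameters, ∀ q ∈ modelParameters, p ≠ q →
        ¬ AreEquivalent (model p.1 p.2) (model q.1 q.2) ∧
        ¬ AreSomewhereLocallyEquivalent (model p.1 p.2) (model q.1 q.2)) := by
  refine ⟨fun M _ _ _ _ _ cov hcov hR h0 hT ↦ ?_, fun x v w ↦ ?_, fun u _ x v w ↦ ⟨?_, ?_⟩,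
    fun p _ ↦ isHomogeneous_christoffelConnection _, fun p hp q hq hpq ↦ ?_⟩
  · obtain ⟨q, hq, h⟩ := exists_isModeledOn hcov hR h0 hT
    rcases hq with rfl | ⟨hu, hv | hv⟩
    · exact Or.inl h
    · exact Or.inr ⟨q.1, hu, Or.inl (hv ▸ h)⟩
    · exact Or.inr ⟨q.1, hu, Or.inr (hv ▸ h)⟩
  · rw [ricci_model, zero_mul]
  · rw [ricci_model, one_mul]
  · rw [ricci_model, neg_one_mul]
  · have h := not_areSomewhereLocallyEquivalent hp hq hpq
    exact ⟨fun he ↦ h he.areSomewhereLocallyEquivalent, h⟩
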